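/- Let $\tau_A,\tau_B,\tau_C,\tau_D\ge 0$ be real numbers. For every integer $n\ge 0$ let $A_n,B_n,C_n,D_n$ be independent Poisson random variables with respective parameters $n\tau_A,n\tau_B,n\tau_C,n\tau_D$ (a Poisson variable with parameter $0$ is almost surely $0$). The event $A_n-B_n=C_n-D_n$ has positive probability; let $X_n=(A_n-B_n\mid A_n-B_n=C_n-D_n)$ denote a random variable distributed as $A_n-B_n$ conditionally on this event. 1. If $\tau_A=\tau_B=0$, or $\tau_B=\tau_C=0$, or $\tau_C=\tau_D=0$, or $\tau_D=\tau_A=0$, then for every $n$ the distribution of $X_n$ is the Dirac measure at $0$. 2. Otherwise, $X_n$ has a finite second moment for every $n$ and, as $n\to\infty$, \[ \mathbb{E}(X_n)=nE+E'+o(1),\qquad \mathbb{V}(X_n)=nV+V'+o(1), \] where \[ E=\frac{\tau_A\tau_C-\tau_B\tau_D}{\sqrt{(\tau_A+\tau_D)(\tau_B+\tau_C)}},\qquad E'=-\frac{\tau_A\tau_C-\tau_B\tau_D}{4(\tau_A+\tau_D)(\tau_B+\tau_C)}, \] \[ V=\frac{(\tau_A\tau_C+2\tau_A\tau_B+\tau_B\tau_D)(\tau_A\tau_C+2\tau_C\tau_D+\tau_B\tau_D)}{2\big[(\tau_A+\tau_D)(\tau_B+\tau_C)\big]^{3/2}},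 \] \[ V'=-\frac{(\tau_A\tau_C+\tau_B\tau_D)(\tau_A\tau_B+\tau_C\tau_D)+4\tau_A\tau_B\tau_C\tau_D}{4\big[(\tau_A+\tau_D)(\tau_B+\tau_C)\big]^2}. \] Moreover $V>0$, and $(X_n-nE)/\sqrt{nV}$ converges in distribution to the standard Gaussian law $\mathcal{N}(0,1)$ as $n\to\infty$. -/

import Mathlib

open MeasureTheory ProbabilityTheory Filter Asymptotics
open scoped NNReal ENNReal Topology

noncomputable section

namespace BalancedPoisson

/-- The event `A - B = C - D` (the differences are taken in `ℤ`). -/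
def balanceEvent {Ω : Type*} (A B C D : Ω → ℕ) : Set Ω :=
  {ω | (A ω : ℤ) - (B ω : ℤ) = (C ω : ℤ) - (D ω : ℤ)}

/-- The probability `μ` conditioned on the event `A - B = C - D`. The law of
`(A - B | A - B = C - D)` is the law of `A - B` under this measure. -/
def balanceCond {Ω : Type*} [MeasurableSpace Ω] (μ : Measure Ω) (A B C D : Ω → ℕ) : Measure Ω :=
  ProbabilityTheory.cond μ (balanceEvent A B C D)

/-- The real random variable `A - B`. -/
def netCount {Ω : Type*} (A B : Ω → ℕ) (ω : Ω) : ℝ := (A ω : ℝ) - (B ω : ℝ)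

/-- Two cyclically adjacent parameters vanish. -/
def Degenerate (a b c d : ℝ≥0) : Prop :=
  (a = 0 ∧ b = 0) ∨ (b = 0 ∧ c = 0) ∨ (c = 0 ∧ d = 0) ∨ (d = 0 ∧ a = 0)

/-- The constant `E`. -/
def meanLead (a b c d : ℝ) : ℝ :=
  (a * c - b * d) / Real.sqrt ((a + d) * (b + c))

/-- The constant `E'`. -/
def meanCorr (a b c d : ℝ) : ℝ :=
  -((a * c - b * d) / (4 * ((a + d) * (b + c))))

/-- The constant `V`. -/
def varLead (a b c d : ℝ) : ℝ :=
  ((a * c + 2 * (a * b) + b * d) * (a * c + 2 * (c * d) + b * d)) /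
    (2 * ((a + d) * (b + c)) ^ (3 / 2 : ℝ))

/-- The constant `V'`. -/
def varCorr (a b c d : ℝ) : ℝ :=
  -(((a * c + b * d) * (a * b + c * d) + 4 * (a * b * c * d)) /
    (4 * ((a + d) * (b + c)) ^ 2))

end BalancedPoisson

end

/-! Everything takes place on `ℕ⁴` under the product Poisson law conditioned on `x 0 + x 3 = x 1 + x
2`; let `K` be this common value, `m = E K`, and `s² = (r 0 + r 3)(r 1 + r 2)`.

Moments. Mecke's formula makes size-biasing a Poisson coordinate a shift by one. Shifting one
coordinate on each side preserves the balance, whence `E K^(p+2) = s² E (K+1)^p`; exchanging two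
coordinates on the same side recovers the factorial moments that a binomial splitting of `K` would
have. The mean and variance of `x 0 - x 1` thus become exact expressions in which `m` is the only
unknown (`integral_sub_balancedLaw`, `variance_sub_balancedLaw`). The recurrence also makes the
moments of `K` up to order seven affine in `m`, so `E (K-s)^6 ≥ 0` and `E K(K-s)^6 ≥ 0` enclose `m`
from both sides: `s - m = 1/4 + 1/(32 s) + O(s⁻²)` (`abs_defect_sub_le`). No asymptotics of Bessel
functions are needed.

Gaussian limit. Multiplying `r 0, r 3` by `ρ` and `r 1, r 2` by `ρ⁻¹` does not change the
conditioned law, so one may assume `r 0 + r 3 = r 1 + r 2` (`balancedLaw_tilt`). Fourier inversion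
writes the conditional characteristic function as a quotient of two integrals over a frequency `θ`.
With `θ = v/√n`, the balanced rates cancel the linear term in `v`, and dominated convergence yields
a quotient of Gaussian integrals (`tendsto_charFun_balancedLaw`). Lévy's continuity theorem
concludes. -/

noncomputable section

namespace BalancedPoisson

/-! ### Products of Poisson laws and Mecke's formula -/

/-- The law of a family of independent Poisson variables with rates `r`. -/
def poissonPi {ι : Type*} [Fintype ι] (r : ι → ℝ≥0) : Measure (ι → ℕ) :=
  Measure.pi fun i => poissonMeasure (r i)

instance {ι : Type*} [Fintype ι] (r : ι → ℝ≥0) : IsProbabilityMeasure (poissonPi r) := by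
  unfold poissonPi; infer_instance

theorem poissonPi_singleton {ι : Type*} [Fintype ι] (r : ι → ℝ≥0) (x : ι → ℕ) :
    poissonPi r {x} = ENNReal.ofReal
      (∏ i, (Real.exp (-(r i)) * (r i) ^ x i / (x i).factorial)) := by
  rw [poissonPi, Measure.pi_singleton, ENNReal.ofReal_prod_of_nonneg]
  · simp [poissonMeasure_singleton]
  · intro i _; positivity

/-- This is `k * r^k / k! = r * r^(k-1) / (k-1)!` in one coordinate. As an identity of measures it
yields an integral formula free of integrability hypotheses. -/
theorem withDensity_poissonPi {ι : Type*} [Fintype ι] [DecidableEq ι] (r : ι → ℝ≥0) (i : ι) :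
    (poissonPi r).withDensity (fun x => (x i : ℝ≥0∞)) =
      (r i : ℝ≥0∞) • (poissonPi r).map (fun x => x + Pi.single i 1) := by
  refine Measure.ext_of_singleton fun x => ?_
  rw [withDensity_apply _ (measurableSet_singleton x), lintegral_singleton, Measure.smul_apply,
    Measure.map_apply .of_discrete (measurableSet_singleton x), smul_eq_mul]
  rcases Nat.eq_zero_or_pos (x i) with h | h
  · have : (fun y : ι → ℕ => y + Pi.single i 1) ⁻¹' {x} = ∅ := by
      ext y
      simp only [Set.mem_preimage, Set.mem_singleton_iff, Set.mem_empty_iff_false, iff_false]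
      rintro rfl
      simp at h
    simp [this, h]
  · obtain ⟨y, rfl⟩ : ∃ y : ι → ℕ, x = y + Pi.single i 1 := by
      refine ⟨x - Pi.single i 1, ?_⟩
      rw [tsub_add_cancel_of_le]
      intro j
      by_cases hj : j = i
      · subst hj; simpa using Nat.succ_le_of_lt h
      · simp [hj]
    have : (fun y : ι → ℕ => y + Pi.single i 1) ⁻¹' {y + Pi.single i 1} = {y} := by
      ext z; simp
    rw [this, poissonPi_singleton, poissonPi_singleton, ← ENNReal.ofReal_natCast,
      ← ENNReal.ofReal_coe_nnreal, ← ENNReal.ofReal_mul (by positivity),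
      ← ENNReal.ofReal_mul (by positivity),
      Fintype.prod_eq_mul_prod_compl i, Fintype.prod_eq_mul_prod_compl i]
    congr 1
    have hp : ∏ j ∈ {i}ᶜ, (Real.exp (-(r j)) * (r j : ℝ) ^ (y + Pi.single i 1 : ι → ℕ) j /
        ((y + Pi.single i 1 : ι → ℕ) j).factorial) =
        ∏ j ∈ {i}ᶜ, (Real.exp (-(r j)) * (r j : ℝ) ^ y j / (y j).factorial) := by
      refine Finset.prod_congr rfl fun j hj => ?_
      have hj : j ≠ i := by simpa using hj
      simp [hj]
    rw [hp]
    simp only [Pi.add_apply, Pi.single_eq_same, Nat.factorial_succ, pow_succ, Nat.cast_mul]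
    field_simp

/-- Mecke's formula. Both sides are integrals of integrable functions or both vanish. -/
theorem integral_coord_mul_poissonPi {ι : Type*} [Fintype ι] [DecidableEq ι] (r : ι → ℝ≥0) (i : ι)
    (f : (ι → ℕ) → ℝ) :
    ∫ x, (x i : ℝ) * f x ∂poissonPi r = r i * ∫ x, f (x + Pi.single i 1) ∂poissonPi r := by
  have h := congrArg (fun μ => ∫ x, f x ∂μ) (withDensity_poissonPi r i)
  beta_reduce at h
  rw [integral_withDensity_eq_integral_toReal_smul .of_discrete (by simp),
    integral_smul_measure, integral_map .of_discrete (by exact Measurable.of_discrete.aestronglyMeasurable)] at h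
  simpa using h

/-! ### The conditioned law and its shift identities -/

/-- The balance condition on `ℕ⁴`. -/
def balanceSet : Set (Fin 4 → ℕ) := {x | (x 0 : ℤ) - x 1 = x 2 - x 3}

/-- The law of four independent Poisson variables conditioned on the balance condition. -/
def balancedLaw (r : Fin 4 → ℝ≥0) : Measure (Fin 4 → ℕ) := cond (poissonPi r) balanceSet

theorem poissonPi_balanceSet_ne_zero (r : Fin 4 → ℝ≥0) : poissonPi r balanceSet ≠ 0 := by
  have h : poissonPi r {0} ≠ 0 := by
    rw [poissonPi_singleton]
    simp only [Pi.zero_apply, pow_zero, ne_eq, ENNReal.ofReal_eq_zero, not_le]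
    positivity
  intro h0
  exact h (measure_mono_null (by simp [balanceSet]) h0)

instance (r : Fin 4 → ℝ≥0) : IsProbabilityMeasure (balancedLaw r) :=
  cond_isProbabilityMeasure (poissonPi_balanceSet_ne_zero r)

theorem ae_balancedLaw (r : Fin 4 → ℝ≥0) : ∀ᵐ x ∂balancedLaw r, x ∈ balanceSet :=
  ae_cond_mem .of_discrete

theorem ae_balancedLaw_add_eq (r : Fin 4 → ℝ≥0) :
    ∀ᵐ x ∂balancedLaw r, (x 1 : ℝ) + x 2 = x 0 + x 3 := by
  filter_upwards [ae_balancedLaw r] with x hx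
  simp only [balanceSet, Set.mem_ofPred_eq] at hx
  have : (x 1 : ℤ) + x 2 = x 0 + x 3 := by linarith
  exact_mod_cast this

theorem integral_balancedLaw {E : Type*} [NormedAddCommGroup E] [NormedSpace ℝ E]
    (r : Fin 4 → ℝ≥0) (f : (Fin 4 → ℕ) → E) :
    ∫ x, f x ∂balancedLaw r =
      ((poissonPi r).real balanceSet)⁻¹ • ∫ x, balanceSet.indicator f x ∂poissonPi r := by
  rw [balancedLaw, ProbabilityTheory.cond, integral_smul_measure, integral_indicator .of_discrete,
    ENNReal.toReal_inv, measureReal_def]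

/-- One more unit on each side of `x 0 + x 3 = x 1 + x 2` preserves the balance, so Mecke's formula
applied twice passes through the indicator, and the normalizing constant is common to both sides. -/
theorem integral_coord_mul_coord_mul_balancedLaw (r : Fin 4 → ℝ≥0) {i j : Fin 4}
    (hi : i = 0 ∨ i = 3) (hj : j = 1 ∨ j = 2) (f : (Fin 4 → ℕ) → ℝ) :
    ∫ x, (x i : ℝ) * (x j * f x) ∂balancedLaw r =
      r i * r j * ∫ x, f (x + Pi.single i 1 + Pi.single j 1) ∂balancedLaw r := by
  have hij : i ≠ j := by rcases hi with rfl | rfl <;> rcases hj with rfl | rfl <;> decide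
  have hmem (x : Fin 4 → ℕ) : x + Pi.single i 1 + Pi.single j 1 ∈ balanceSet ↔ x ∈ balanceSet := by
    rcases hi with rfl | rfl <;> rcases hj with rfl | rfl <;>
      simp [balanceSet] <;> omega
  rw [integral_balancedLaw, integral_balancedLaw]
  have h1 : balanceSet.indicator (fun x : Fin 4 → ℕ => (x i : ℝ) * (x j * f x)) =
      fun x => (x i : ℝ) * (x j * balanceSet.indicator f x) := by
    ext x; by_cases hx : x ∈ balanceSet <;> simp [hx]
  have h2 (x : Fin 4 → ℕ) : balanceSet.indicator f (x + Pi.single i 1 + Pi.single j 1) =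
      balanceSet.indicator (fun x => f (x + Pi.single i 1 + Pi.single j 1)) x := by
    by_cases hx : x ∈ balanceSet <;> simp [hx, hmem]
  rw [h1, integral_coord_mul_poissonPi]
  simp only [Pi.add_apply, Pi.single_eq_of_ne' hij, add_zero]
  have h3 := integral_coord_mul_poissonPi r j (fun x => balanceSet.indicator f (x + Pi.single i 1))
  refine (congrArg (fun y => _ • (_ * y)) h3).trans ?_
  simp only [add_right_comm _ (Pi.single j 1) (Pi.single i 1), h2, smul_eq_mul]
  ring

/-- For `i`, `j` on the same side of the balance, a unit added at `i` or at `j` has the same effect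
on it. By Mecke's formula both sides are `r i * r j` times the same integral. -/
theorem exchange_balancedLaw (r : Fin 4 → ℝ≥0) {i j : Fin 4}
    (hij : (i = 0 ∧ j = 3) ∨ (i = 3 ∧ j = 0) ∨ (i = 1 ∧ j = 2) ∨ (i = 2 ∧ j = 1))
    {f g : (Fin 4 → ℕ) → ℝ} (h : ∀ x : Fin 4 → ℕ, f (x + Pi.single i 1) = g (x + Pi.single j 1)) :
    r j * ∫ x, (x i : ℝ) * f x ∂balancedLaw r = r i * ∫ x, (x j : ℝ) * g x ∂balancedLaw r := by
  have hmem (x : Fin 4 → ℕ) : x + Pi.single i 1 ∈ balanceSet ↔ x + Pi.single j 1 ∈ balanceSet := by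
    rcases hij with ⟨rfl, rfl⟩ | ⟨rfl, rfl⟩ | ⟨rfl, rfl⟩ | ⟨rfl, rfl⟩ <;>
      simp [balanceSet] <;> omega
  have hind (k : Fin 4) (f : (Fin 4 → ℕ) → ℝ) :
      balanceSet.indicator (fun x : Fin 4 → ℕ => (x k : ℝ) * f x) =
      fun x => (x k : ℝ) * balanceSet.indicator f x := by
    ext x; by_cases hx : x ∈ balanceSet <;> simp [hx]
  rw [integral_balancedLaw, integral_balancedLaw, hind, hind, integral_coord_mul_poissonPi,
    integral_coord_mul_poissonPi]
  have h2 (x : Fin 4 → ℕ) : balanceSet.indicator f (x + Pi.single i 1) =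
      balanceSet.indicator g (x + Pi.single j 1) := by
    by_cases hx : x + Pi.single j 1 ∈ balanceSet
    · rw [Set.indicator_of_mem hx, Set.indicator_of_mem ((hmem x).2 hx), h]
    · rw [Set.indicator_of_notMem hx, Set.indicator_of_notMem (mt (hmem x).1 hx)]
  simp only [h2, smul_eq_mul]
  ring

/-! ### Integrability and the moment recurrence -/

theorem integrable_pow_poissonMeasure (r : ℝ≥0) (p : ℕ) :
    Integrable (fun k : ℕ => (k : ℝ) ^ p) (poissonMeasure r) := by
  rw [integrable_poissonMeasure_iff]
  -- The bound `n^p ≤ p! * exp n` leads to an exponential series with parameter `r * e`.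
  have hs : Summable fun n : ℕ => Real.exp (-r) * p.factorial *
      ((r * Real.exp 1) ^ n / n.factorial) :=
    (Real.summable_pow_div_factorial _).mul_left _
  refine Summable.of_nonneg_of_le (fun n => by positivity) (fun n => ?_) hs
  have h := Real.pow_div_factorial_le_exp (n : ℝ) (by positivity) p
  rw [div_le_iff₀ (by positivity)] at h
  rw [Real.norm_of_nonneg (by positivity), mul_pow, ← Real.exp_nat_mul, mul_one]
  calc Real.exp (-r) * (r : ℝ) ^ n / n.factorial * (n : ℝ) ^ p
      ≤ Real.exp (-r) * (r : ℝ) ^ n / n.factorial * (Real.exp n * p.factorial) := by gcongr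
    _ = _ := by ring

theorem memLp_coord_poissonPi {ι : Type*} [Fintype ι] (r : ι → ℝ≥0) (i : ι) (p : ℕ) :
    MemLp (fun x : ι → ℕ => (x i : ℝ)) p (poissonPi r) := by
  have h : MemLp (fun k : ℕ => (k : ℝ)) p (poissonMeasure (r i)) := by
    rcases Nat.eq_zero_or_pos p with rfl | hp
    · simpa using Measurable.of_discrete.aestronglyMeasurable
    rw [← integrable_norm_rpow_iff Measurable.of_discrete.aestronglyMeasurable
      (by simpa using hp.ne') (by simp)]
    simpa using integrable_pow_poissonMeasure (r i) p
  exact h.comp_measurePreserving (measurePreserving_eval (fun i => poissonMeasure (r i)) i)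

theorem MemLp.balancedLaw {r : Fin 4 → ℝ≥0} {f : (Fin 4 → ℕ) → ℝ} {p : ℝ≥0∞}
    (h : MemLp f p (poissonPi r)) : MemLp f p (balancedLaw r) := by
  refine (h.restrict balanceSet).smul_measure ?_
  exact ENNReal.inv_ne_top.2 (poissonPi_balanceSet_ne_zero r)

theorem memLp_coord_balancedLaw (r : Fin 4 → ℝ≥0) (i : Fin 4) (p : ℕ) :
    MemLp (fun x => (x i : ℝ)) p (balancedLaw r) :=
  MemLp.balancedLaw (memLp_coord_poissonPi r i p)

theorem integrable_of_le_sum_pow (r : Fin 4 → ℝ≥0) {f : (Fin 4 → ℕ) → ℝ} (p : ℕ)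
    (hf : ∀ x, |f x| ≤ ((x 0 : ℝ) + x 1 + x 2 + x 3) ^ p) : Integrable f (balancedLaw r) := by
  have h : MemLp (fun x : Fin 4 → ℕ => (x 0 : ℝ) + x 1 + x 2 + x 3) p (balancedLaw r) :=
    (((memLp_coord_balancedLaw r 0 p).add (memLp_coord_balancedLaw r 1 p)).add
      (memLp_coord_balancedLaw r 2 p)).add (memLp_coord_balancedLaw r 3 p)
  refine h.integrable_norm_pow'.mono' Measurable.of_discrete.aestronglyMeasurable (ae_of_all _ fun x => ?_)
  rw [Real.norm_eq_abs, Real.norm_of_nonneg (by positivity)]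
  exact hf x

theorem integrable_pow_coord_add (r : Fin 4 → ℝ≥0) (p : ℕ) :
    Integrable (fun x => ((x 0 : ℝ) + x 3) ^ p) (balancedLaw r) := by
  refine integrable_of_le_sum_pow r p fun x => ?_
  rw [abs_of_nonneg (by positivity)]
  gcongr
  have := (x 1).cast_nonneg (α := ℝ)
  have := (x 2).cast_nonneg (α := ℝ)
  linarith

/-- Almost surely `K² = (x 0 + x 3)(x 1 + x 2)`; each of the four products is removed by a double
shift, which raises `K` by one. -/
theorem integral_pow_add_two_balancedLaw (r : Fin 4 → ℝ≥0) (p : ℕ) :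
    ∫ x, ((x 0 : ℝ) + x 3) ^ (p + 2) ∂balancedLaw r =
      ((r 0 + r 3) * (r 1 + r 2)) * ∫ x, ((x 0 : ℝ) + x 3 + 1) ^ p ∂balancedLaw r := by
  have hint (i j : Fin 4) : Integrable (fun x => (x i : ℝ) * (x j * ((x 0 : ℝ) + x 3) ^ p))
      (balancedLaw r) := by
    have hle (i : Fin 4) (x : Fin 4 → ℕ) : (x i : ℝ) ≤ (x 0 : ℝ) + x 1 + x 2 + x 3 := by
      rw [← Fin.sum_univ_four (fun i => (x i : ℝ))]
      exact Finset.single_le_sum (f := fun i => (x i : ℝ)) (by intros; positivity) (Finset.mem_univ i)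
    refine integrable_of_le_sum_pow r (p + 2) fun x => ?_
    rw [abs_of_nonneg (by positivity), pow_add, pow_two, mul_comm (_ ^ p), mul_assoc]
    have : (x 0 : ℝ) + x 3 ≤ (x 0 : ℝ) + x 1 + x 2 + x 3 := by
      have := (x 1).cast_nonneg (α := ℝ)
      have := (x 2).cast_nonneg (α := ℝ)
      linarith
    have := hle i x
    have := hle j x
    gcongr
  have key (i j : Fin 4) (hi : i = 0 ∨ i = 3) (hj : j = 1 ∨ j = 2) :
      ∫ x, (x i : ℝ) * (x j * ((x 0 : ℝ) + x 3) ^ p) ∂balancedLaw r =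
      r i * r j * ∫ x, ((x 0 : ℝ) + x 3 + 1) ^ p ∂balancedLaw r := by
    rw [integral_coord_mul_coord_mul_balancedLaw r hi hj]
    congr 2
    ext x
    congr 1
    rcases hi with rfl | rfl <;> rcases hj with rfl | rfl <;> simp <;> ring
  have h : ∫ x, ((x 0 : ℝ) + x 3) ^ (p + 2) ∂balancedLaw r =
      ∫ x, (((x 0 : ℝ) * (x 1 * ((x 0 : ℝ) + x 3) ^ p) + x 0 * (x 2 * ((x 0 : ℝ) + x 3) ^ p)) +
        ((x 3 : ℝ) * (x 1 * ((x 0 : ℝ) + x 3) ^ p) + x 3 * (x 2 * ((x 0 : ℝ) + x 3) ^ p)))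
        ∂balancedLaw r := by
    refine integral_congr_ae ?_
    filter_upwards [ae_balancedLaw_add_eq r] with x hx
    linear_combination (-(x 0 : ℝ) - x 3) * ((x 0 : ℝ) + x 3) ^ p * hx
  rw [h, integral_add (by exact (hint 0 1).add (hint 0 2)) (by exact (hint 3 1).add (hint 3 2)),
    integral_add (hint 0 1) (hint 0 2), integral_add (hint 3 1) (hint 3 2),
    key 0 1 (by decide) (by decide), key 0 2 (by decide) (by decide),
    key 3 1 (by decide) (by decide), key 3 2 (by decide) (by decide)]
  ring

/-! ### Two-sided estimate of the mean from positivity of sixth powers -/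

section BesselMoments

variable {α : Type*} [MeasurableSpace α] {Q : Measure α} [IsProbabilityMeasure Q] {K : α → ℝ}
  {s : ℝ}

/-- The moments up to order seven of a variable with law proportional to `s ^ (2 * k) / k! ^ 2`, as
affine functions of the first one. -/
theorem moments_of_recurrence (hint : ∀ p : ℕ, Integrable (fun x => K x ^ p) Q)
    (hrec : ∀ p : ℕ, ∫ x, K x ^ (p + 2) ∂Q = s ^ 2 * ∫ x, (K x + 1) ^ p ∂Q) :
    let m := ∫ x, K x ∂Q
    (∫ x, K x ^ 2 ∂Q = s ^ 2) ∧
    (∫ x, K x ^ 3 ∂Q = s ^ 2 * (m + 1)) ∧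
    (∫ x, K x ^ 4 ∂Q = s ^ 2 * (s ^ 2 + 2 * m + 1)) ∧
    (∫ x, K x ^ 5 ∂Q = s ^ 2 * (s ^ 2 * (m + 1) + 3 * s ^ 2 + 3 * m + 1)) ∧
    (∫ x, K x ^ 6 ∂Q = s ^ 2 * (s ^ 2 * (s ^ 2 + 2 * m + 1) + 4 * (s ^ 2 * (m + 1)) + 6 * s ^ 2
      + 4 * m + 1)) ∧
    (∫ x, K x ^ 7 ∂Q = s ^ 2 * (s ^ 2 * (s ^ 2 * (m + 1) + 3 * s ^ 2 + 3 * m + 1)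
      + 5 * (s ^ 2 * (s ^ 2 + 2 * m + 1)) + 10 * (s ^ 2 * (m + 1)) + 10 * s ^ 2 + 5 * m + 1)) := by
  intro m
  have hm : ∫ x, K x ^ 1 ∂Q = m := by simp [m]
  have h0 : ∫ x, K x ^ 0 ∂Q = 1 := by simp
  have hb (p : ℕ) : ∫ x, (K x + 1) ^ p ∂Q =
      ∑ k ∈ Finset.range (p + 1), (p.choose k : ℝ) * ∫ x, K x ^ k ∂Q := by
    simp only [add_pow, one_pow, mul_one]
    rw [integral_finsetSum _ fun k _ => (hint k).mul_const _]
    simp only [integral_mul_const, mul_comm]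
  have e2 := hrec 0
  have e3 := hrec 1
  have e4 := hrec 2
  have e5 := hrec 3
  have e6 := hrec 4
  have e7 := hrec 5
  simp only [hb, Finset.sum_range_succ, Finset.sum_range_zero, hm, h0] at e2 e3 e4 e5 e6 e7
  norm_num [Nat.choose] at e2 e3 e4 e5 e6 e7
  rw [e2] at e4 e5 e6 e7
  rw [e3] at e5 e6 e7
  rw [e4] at e6 e7
  rw [e5] at e7
  refine ⟨e2, ?_, ?_, ?_, ?_, ?_⟩ <;> linarith

/-- This expands `E (K-s)^6 ≥ 0`. The sixth power is chosen for precision: the slack is expected to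
be of order `s³` against a coefficient `32 s⁵`, an error `O(s⁻²)`. A fourth power would leave an
error of order `1/s`, too large for the variance. -/
theorem defect_lower_bound (hint : ∀ p : ℕ, Integrable (fun x => K x ^ p) Q)
    (hrec : ∀ p : ℕ, ∫ x, K x ^ (p + 2) ∂Q = s ^ 2 * ∫ x, (K x + 1) ^ p ∂Q) :
    8 * s ^ 5 - 8 * s ^ 4 + 2 * s ^ 3 - s ^ 2 ≤
      (s - ∫ x, K x ∂Q) * (32 * s ^ 5 - 36 * s ^ 4 + 18 * s ^ 3 - 4 * s ^ 2) := by
  obtain ⟨h2, h3, h4, h5, h6, -⟩ := moments_of_recurrence hint hrec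
  have h : 0 ≤ ∫ x, (K x + -s) ^ 6 ∂Q := integral_nonneg fun x => by positivity
  simp only [add_pow] at h
  rw [integral_finsetSum _ fun k _ => ((hint k).mul_const _).mul_const _] at h
  simp only [integral_mul_const, Finset.sum_range_succ, Finset.sum_range_zero, h2, h3, h4, h5, h6,
    pow_one] at h
  norm_num [Nat.choose] at h
  linarith

/-- The extra weight `K ≥ 0` reverses the sign of the leading coefficient of the defect, so
positivity now bounds it from above. -/
theorem defect_upper_bound (hK : ∀ x, 0 ≤ K x) (hint : ∀ p : ℕ, Integrable (fun x => K x ^ p) Q)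
    (hrec : ∀ p : ℕ, ∫ x, K x ^ (p + 2) ∂Q = s ^ 2 * ∫ x, (K x + 1) ^ p ∂Q) :
    (s - ∫ x, K x ∂Q) * (32 * s ^ 6 - 76 * s ^ 5 + 68 * s ^ 4 - 24 * s ^ 3 + 5 * s ^ 2) ≤
      8 * s ^ 6 - 18 * s ^ 5 + 17 * s ^ 4 - s ^ 3 + s ^ 2 := by
  obtain ⟨h2, h3, h4, h5, h6, h7⟩ := moments_of_recurrence hint hrec
  have h : 0 ≤ ∫ x, K x * (K x + -s) ^ 6 ∂Q :=
    integral_nonneg fun x => mul_nonneg (hK x) (by positivity)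
  simp only [add_pow, Finset.mul_sum, ← mul_assoc, ← pow_succ'] at h
  rw [integral_finsetSum _ fun k _ => ((hint _).mul_const _).mul_const _] at h
  simp only [integral_mul_const, Finset.sum_range_succ, Finset.sum_range_zero, h2, h3, h4, h5, h6,
    h7, zero_add, Nat.reduceAdd, pow_one] at h
  norm_num [Nat.choose] at h
  linarith

theorem abs_defect_sub_le (hs : 100 ≤ s) (hK : ∀ x, 0 ≤ K x)
    (hint : ∀ p : ℕ, Integrable (fun x => K x ^ p) Q)
    (hrec : ∀ p : ℕ, ∫ x, K x ^ (p + 2) ∂Q = s ^ 2 * ∫ x, (K x + 1) ^ p ∂Q) :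
    |s - ∫ x, K x ∂Q - (1 / 4 + s⁻¹ / 32)| ≤ s⁻¹ ^ 2 := by
  have hl := defect_lower_bound hint hrec
  have hu := defect_upper_bound hK hint hrec
  set δ := s - ∫ x, K x ∂Q
  obtain ⟨u, rfl⟩ : ∃ u, s = u⁻¹ := ⟨s⁻¹, by simp⟩
  have hu0 : 0 < u := by
    by_contra! h
    have := inv_nonpos.2 h
    linarith
  have hu1 : u ≤ 1 / 100 := by
    rw [le_inv_comm₀ (by norm_num) hu0] at hs
    linarith
  rw [inv_inv]
  have hl' : 8 - 8 * u + 2 * u ^ 2 - u ^ 3 ≤ δ * (32 - 36 * u + 18 * u ^ 2 - 4 * u ^ 3) := by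
    have := mul_le_mul_of_nonneg_right hl (pow_nonneg hu0.le 5)
    field_simp at this
    linarith
  have hu' : δ * (32 - 76 * u + 68 * u ^ 2 - 24 * u ^ 3 + 5 * u ^ 4) ≤
      8 - 18 * u + 17 * u ^ 2 - u ^ 3 + u ^ 4 := by
    have := mul_le_mul_of_nonneg_right hu (pow_nonneg hu0.le 6)
    field_simp at this
    linarith
  have a2 : 0 ≤ u ^ 2 := by positivity
  have a3 : 0 ≤ u ^ 3 := by positivity
  have a4 : 0 ≤ u ^ 4 := by positivity
  -- Since `u = 1/s ≤ 1/100`, all higher powers are absorbed into a small multiple of `u ^ 2`.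
  have b3 : u ^ 3 ≤ u ^ 2 / 100 := by nlinarith
  have b4 : u ^ 4 ≤ u ^ 2 / 100 := by nlinarith
  have b5 : u ^ 5 ≤ u ^ 2 / 100 := by nlinarith
  have b6 : u ^ 6 ≤ u ^ 2 / 100 := by nlinarith
  have a5 : 0 ≤ u ^ 5 := by positivity
  have a6 : 0 ≤ u ^ 6 := by positivity
  rw [abs_le]
  constructor
  · by_contra! h
    have hp : 0 < 32 - 36 * u + 18 * u ^ 2 - 4 * u ^ 3 := by linarith
    have := mul_lt_mul_of_pos_right (show δ < 1 / 4 + u / 32 - u ^ 2 by linarith) hp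
    nlinarith
  · by_contra! h
    have hp : 0 < 32 - 76 * u + 68 * u ^ 2 - 24 * u ^ 3 + 5 * u ^ 4 := by linarith
    have := mul_lt_mul_of_pos_right (show 1 / 4 + u / 32 + u ^ 2 < δ by linarith) hp
    nlinarith

end BesselMoments

/-! ### Exact mean and variance in terms of the mean of `K` -/

theorem integrable_coord (r : Fin 4 → ℝ≥0) (i : Fin 4) :
    Integrable (fun x => (x i : ℝ)) (balancedLaw r) := by
  simpa using (memLp_coord_balancedLaw r i 1).integrable (by simp)

theorem integrable_coord_mul_coord (r : Fin 4 → ℝ≥0) (i j : Fin 4) :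
    Integrable (fun x => (x i : ℝ) * x j) (balancedLaw r) := by
  have hi : MemLp (fun x => (x i : ℝ)) 2 (balancedLaw r) := by
    simpa using memLp_coord_balancedLaw r i 2
  have hj : MemLp (fun x => (x j : ℝ)) 2 (balancedLaw r) := by
    simpa using memLp_coord_balancedLaw r j 2
  exact hi.integrable_mul hj

theorem integrable_coord_mul_pred (r : Fin 4 → ℝ≥0) (i : Fin 4) :
    Integrable (fun x => (x i : ℝ) * (x i - 1)) (balancedLaw r) := by
  simp only [mul_sub, mul_one]
  exact (integrable_coord_mul_coord r i i).sub (integrable_coord r i)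

/-- The mean of the common value `x 0 + x 3 = x 1 + x 2`. -/
def totalMean (r : Fin 4 → ℝ≥0) : ℝ := ∫ x, ((x 0 : ℝ) + x 3) ∂balancedLaw r

theorem integral_sq_coord_add (r : Fin 4 → ℝ≥0) :
    ∫ x, ((x 0 : ℝ) + x 3) ^ 2 ∂balancedLaw r = (r 0 + r 3) * (r 1 + r 2) := by
  simpa using integral_pow_add_two_balancedLaw r 0

theorem integral_coord_balancedLaw (r : Fin 4 → ℝ≥0) {i j : Fin 4}
    (hij : (i = 0 ∧ j = 3) ∨ (i = 1 ∧ j = 2)) :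
    (r i + r j) * ∫ x, (x i : ℝ) ∂balancedLaw r = r i * totalMean r := by
  have hK : ∀ᵐ x ∂balancedLaw r, (x 0 : ℝ) + x 3 = x i + x j := by
    filter_upwards [ae_balancedLaw_add_eq r] with x hx
    rcases hij with ⟨rfl, rfl⟩ | ⟨rfl, rfl⟩
    · rfl
    · exact hx.symm
  have h1 := exchange_balancedLaw r (i := i) (j := j) (by tauto) (f := fun _ => 1)
    (g := fun _ => 1) (fun _ => rfl)
  simp only [mul_one] at h1
  rw [totalMean, integral_congr_ae hK, integral_add (integrable_coord r i) (integrable_coord r j)]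
  linear_combination h1

/-- Two exchanges express `E x i (x i - 1)` and `E x j (x j - 1)` through `E x i x j`; the sum `E
K(K-1)` closes the linear system. -/
theorem integral_coord_mul_pred_balancedLaw (r : Fin 4 → ℝ≥0) {i j : Fin 4}
    (hij : (i = 0 ∧ j = 3) ∨ (i = 1 ∧ j = 2)) :
    ((r i : ℝ) + r j) ^ 2 * ∫ x, (x i : ℝ) * (x i - 1) ∂balancedLaw r =
      r i ^ 2 * ((r 0 + r 3) * (r 1 + r 2) - totalMean r) := by
  have hne : i ≠ j := by rcases hij with ⟨rfl, rfl⟩ | ⟨rfl, rfl⟩ <;> decide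
  have hK : ∀ᵐ x ∂balancedLaw r, (x 0 : ℝ) + x 3 = x i + x j := by
    filter_upwards [ae_balancedLaw_add_eq r] with x hx
    rcases hij with ⟨rfl, rfl⟩ | ⟨rfl, rfl⟩
    · rfl
    · exact hx.symm
  have h1 := exchange_balancedLaw r (i := i) (j := j) (by tauto) (f := fun x => (x i : ℝ) - 1)
    (g := fun x => x i) (fun x => by simp [hne])
  have h2 := exchange_balancedLaw r (i := j) (j := i) (by tauto) (f := fun x => (x j : ℝ) - 1)
    (g := fun x => x j) (fun x => by simp [hne.symm])
  have hp := integrable_coord_mul_pred r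
  have h3 : (∫ x, (x i : ℝ) * (x i - 1) ∂balancedLaw r) + (∫ x, (x j : ℝ) * (x j - 1) ∂balancedLaw r)
      + 2 * (∫ x, (x i : ℝ) * x j ∂balancedLaw r) =
      (r 0 + r 3) * (r 1 + r 2) - totalMean r := by
    rw [← integral_sq_coord_add, totalMean, ← integral_const_mul, ← integral_add (hp i) (hp j),
      ← integral_add (by exact (hp i).add (hp j))
        (by exact (integrable_coord_mul_coord r i j).const_mul 2),
      ← integral_sub (integrable_pow_coord_add r 2) (by simpa using integrable_pow_coord_add r 1)]
    refine integral_congr_ae ?_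
    filter_upwards [hK] with x hx
    rw [hx]
    ring
  have hc : ∫ x, (x j : ℝ) * x i ∂balancedLaw r = ∫ x, (x i : ℝ) * x j ∂balancedLaw r := by
    simp only [mul_comm]
  rw [hc] at h1
  rw [← h3]
  linear_combination (r j + 2 * r i : ℝ) * h1 - r i * h2

theorem integral_coord_zero_mul_coord_one (r : Fin 4 → ℝ≥0) :
    ∫ x, (x 0 : ℝ) * x 1 ∂balancedLaw r = r 0 * r 1 := by
  simpa using integral_coord_mul_coord_mul_balancedLaw r (i := 0) (j := 1) (by decide) (by decide)
    (fun _ => 1)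

theorem memLp_sub_balancedLaw (r : Fin 4 → ℝ≥0) :
    MemLp (fun x => (x 0 : ℝ) - x 1) 2 (balancedLaw r) := by
  have h0 := memLp_coord_balancedLaw r 0 2
  have h1 := memLp_coord_balancedLaw r 1 2
  rw [Nat.cast_ofNat] at h0 h1
  exact h0.sub h1

theorem integral_sub_balancedLaw (r : Fin 4 → ℝ≥0) (h03 : r 0 + r 3 ≠ 0) (h12 : r 1 + r 2 ≠ 0) :
    ∫ x, ((x 0 : ℝ) - x 1) ∂balancedLaw r =
      (r 0 * r 2 - r 1 * r 3) / ((r 0 + r 3) * (r 1 + r 2)) * totalMean r := by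
  have h03' : (r 0 + r 3 : ℝ) ≠ 0 := by exact_mod_cast h03
  have h12' : (r 1 + r 2 : ℝ) ≠ 0 := by exact_mod_cast h12
  have h0 := integral_coord_balancedLaw r (i := 0) (j := 3) (by decide)
  have h1 := integral_coord_balancedLaw r (i := 1) (j := 2) (by decide)
  rw [integral_sub (integrable_coord r 0) (integrable_coord r 1)]
  field_simp
  linear_combination (r 1 + r 2 : ℝ) * h0 - (r 0 + r 3 : ℝ) * h1

/-- The shape is that of the law of total variance for two independent binomial splittings of `K`,
with `Var K = s² - m²`; here it is checked from the factorial moments and `E x 0 x 1 = r 0 * r 1`.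
-/
theorem variance_sub_balancedLaw (r : Fin 4 → ℝ≥0) (h03 : r 0 + r 3 ≠ 0) (h12 : r 1 + r 2 ≠ 0) :
    variance (fun x => (x 0 : ℝ) - x 1) (balancedLaw r) =
      ((r 0 * r 2 - r 1 * r 3) / ((r 0 + r 3) * (r 1 + r 2))) ^ 2 *
        ((r 0 + r 3) * (r 1 + r 2) - totalMean r ^ 2) +
      ((r 0 * r 3) / (r 0 + r 3) ^ 2 + (r 1 * r 2) / (r 1 + r 2) ^ 2) * totalMean r := by
  have h03' : (r 0 + r 3 : ℝ) ≠ 0 := by exact_mod_cast h03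
  have h12' : (r 1 + r 2 : ℝ) ≠ 0 := by exact_mod_cast h12
  have h0 := integral_coord_balancedLaw r (i := 0) (j := 3) (by decide)
  have h1 := integral_coord_balancedLaw r (i := 1) (j := 2) (by decide)
  have h00 := integral_coord_mul_pred_balancedLaw r (i := 0) (j := 3) (by decide)
  have h11 := integral_coord_mul_pred_balancedLaw r (i := 1) (j := 2) (by decide)
  have h01 := integral_coord_zero_mul_coord_one r
  have hp := integrable_coord_mul_pred r
  have hsq : ∫ x, ((x 0 : ℝ) - x 1) ^ 2 ∂balancedLaw r =
      (∫ x, (x 0 : ℝ) * (x 0 - 1) ∂balancedLaw r) + (∫ x, (x 0 : ℝ) ∂balancedLaw r)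
      + ((∫ x, (x 1 : ℝ) * (x 1 - 1) ∂balancedLaw r) + (∫ x, (x 1 : ℝ) ∂balancedLaw r))
      - 2 * ∫ x, (x 0 : ℝ) * x 1 ∂balancedLaw r := by
    rw [← integral_const_mul, ← integral_add (hp 0) (integrable_coord r 0),
      ← integral_add (hp 1) (integrable_coord r 1),
      ← integral_add (by exact (hp 0).add (integrable_coord r 0))
        (by exact (hp 1).add (integrable_coord r 1)), ← integral_sub]
    · congr 1
      ext x
      ring
    · exact ((hp 0).add (integrable_coord r 0)).add ((hp 1).add (integrable_coord r 1))
    · exact (integrable_coord_mul_coord r 0 1).const_mul 2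
  rw [variance_eq_sub (memLp_sub_balancedLaw r), integral_sub_balancedLaw r h03 h12]
  simp only [Pi.pow_apply]
  rw [hsq, h01, eq_div_of_mul_eq h03' ((mul_comm _ _).trans h0),
    eq_div_of_mul_eq h12' ((mul_comm _ _).trans h1),
    eq_div_of_mul_eq (pow_ne_zero 2 h03') ((mul_comm _ _).trans h00),
    eq_div_of_mul_eq (pow_ne_zero 2 h12') ((mul_comm _ _).trans h11)]
  field_simp
  ring

/-! ### Asymptotic expansions of mean and variance -/

theorem tendsto_of_defect_bound {s m : ℕ → ℝ} (hs : Tendsto s atTop atTop)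
    (h : ∀ᶠ n in atTop, |s n - m n - (1 / 4 + (s n)⁻¹ / 32)| ≤ (s n)⁻¹ ^ 2) :
    Tendsto (fun n => m n - s n + 1 / 4) atTop (𝓝 0) ∧
      Tendsto (fun n => s n ^ 2 - m n ^ 2 - s n / 2) atTop (𝓝 0) := by
  have hu : Tendsto (fun n => (s n)⁻¹) atTop (𝓝 0) := tendsto_inv_atTop_zero.comp hs
  set e : ℕ → ℝ := fun n => s n - m n - (1 / 4 + (s n)⁻¹ / 32)
  have he : Tendsto e atTop (𝓝 0) :=
    squeeze_zero_norm' h (by simpa using hu.pow 2)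
  have hse : Tendsto (fun n => s n * e n) atTop (𝓝 0) := by
    refine squeeze_zero_norm' ?_ hu
    filter_upwards [h, hs.eventually_gt_atTop 0] with n hn h0
    rw [norm_mul, Real.norm_of_nonneg h0.le, Real.norm_eq_abs]
    calc s n * |e n| ≤ s n * (s n)⁻¹ ^ 2 := by gcongr
      _ = (s n)⁻¹ := by field_simp
  have hm : Tendsto (fun n => m n - s n + 1 / 4) atTop (𝓝 0) := by
    have := (he.add (hu.div_const 32)).neg
    simp only [zero_div, add_zero, neg_zero] at this
    refine this.congr fun n => ?_
    simp only [e]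
    ring
  refine ⟨hm, ?_⟩
  -- With `δ = s - m`, `s² - m² = 2sδ - δ²`. The term `1/(32 s)` of `δ` contributes `1/16`, which
  -- cancels the limit of `δ²`; hence the need for the second-order term.
  have := ((hse.const_mul 2).add_const (1 / 16)).sub ((hm.sub_const (1 / 4)).pow 2)
  norm_num at this
  refine this.congr' ?_
  filter_upwards [hs.eventually_gt_atTop 0] with n h0
  simp only [e]
  field_simp
  ring

theorem tendsto_totalMean (r : Fin 4 → ℝ≥0) (h03 : r 0 + r 3 ≠ 0) (h12 : r 1 + r 2 ≠ 0) :
    let q := Real.sqrt ((r 0 + r 3) * (r 1 + r 2))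
    Tendsto (fun n : ℕ => totalMean (fun i => n * r i) - n * q + 1 / 4) atTop (𝓝 0) ∧
      Tendsto (fun n : ℕ => (n * q) ^ 2 - totalMean (fun i => n * r i) ^ 2 - n * q / 2)
        atTop (𝓝 0) := by
  intro q
  have h03' : 0 < (r 0 + r 3 : ℝ) := by exact_mod_cast pos_iff_ne_zero.2 h03
  have h12' : 0 < (r 1 + r 2 : ℝ) := by exact_mod_cast pos_iff_ne_zero.2 h12
  have hq : 0 < q := Real.sqrt_pos.2 (by positivity)
  have hq2 : q ^ 2 = (r 0 + r 3) * (r 1 + r 2) := Real.sq_sqrt (by positivity)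
  have hs : Tendsto (fun n : ℕ => n * q) atTop atTop :=
    tendsto_natCast_atTop_atTop.atTop_mul_const hq
  refine tendsto_of_defect_bound hs ?_
  filter_upwards [hs.eventually_ge_atTop 100] with n hn
  refine abs_defect_sub_le hn (fun x => by positivity) (integrable_pow_coord_add _) fun p => ?_
  rw [integral_pow_add_two_balancedLaw, mul_pow, hq2]
  push_cast
  ring

theorem rpow_three_halves {x : ℝ} (hx : 0 ≤ x) : x ^ (3 / 2 : ℝ) = Real.sqrt x ^ 3 := by
  rw [Real.rpow_div_two_eq_sqrt _ hx, ← Real.rpow_natCast]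
  norm_num

/-- The factor of `totalMean` is homogeneous of degree zero in the rates, so the expansion `n q -
1/4 + o(1)` is simply multiplied by it. -/
theorem tendsto_mean_balancedLaw (r : Fin 4 → ℝ≥0) (h03 : r 0 + r 3 ≠ 0) (h12 : r 1 + r 2 ≠ 0) :
    Tendsto (fun n : ℕ => (∫ x, ((x 0 : ℝ) - x 1) ∂balancedLaw (fun i => n * r i)) -
      (n * meanLead (r 0) (r 1) (r 2) (r 3) + meanCorr (r 0) (r 1) (r 2) (r 3))) atTop (𝓝 0) := by
  have h := (tendsto_totalMean r h03 h12).1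
  have h03' : 0 < (r 0 + r 3 : ℝ) := by exact_mod_cast pos_iff_ne_zero.2 h03
  have h12' : 0 < (r 1 + r 2 : ℝ) := by exact_mod_cast pos_iff_ne_zero.2 h12
  have := h.const_mul ((r 0 * r 2 - r 1 * r 3) / ((r 0 + r 3) * (r 1 + r 2)) : ℝ)
  rw [mul_zero] at this
  refine this.congr' ?_
  filter_upwards [eventually_ne_atTop 0] with n hn
  have hn' : (n : ℝ≥0) ≠ 0 := by exact_mod_cast hn
  have hn'' : (n : ℝ) ≠ 0 := by exact_mod_cast hn
  rw [integral_sub_balancedLaw _ (by rw [← mul_add]; positivity) (by rw [← mul_add]; positivity),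
    meanLead, meanCorr]
  set q := Real.sqrt ((r 0 + r 3) * (r 1 + r 2))
  have hq : 0 < q := Real.sqrt_pos.2 (by positivity)
  have hq2 : ((r 0 + r 3) * (r 1 + r 2) : ℝ) = q ^ 2 := (Real.sq_sqrt (by positivity)).symm
  push_cast
  rw [← mul_add, ← mul_add, show ((n * (r 0 + r 3 : ℝ)) * (n * (r 1 + r 2))) =
    n ^ 2 * ((r 0 + r 3) * (r 1 + r 2)) by ring, hq2]
  field_simp
  ring

theorem tendsto_variance_balancedLaw (r : Fin 4 → ℝ≥0) (h03 : r 0 + r 3 ≠ 0)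
    (h12 : r 1 + r 2 ≠ 0) :
    Tendsto (fun n : ℕ => variance (fun x => (x 0 : ℝ) - x 1) (balancedLaw (fun i => n * r i)) -
      (n * varLead (r 0) (r 1) (r 2) (r 3) + varCorr (r 0) (r 1) (r 2) (r 3))) atTop (𝓝 0) := by
  obtain ⟨h1, h2⟩ := tendsto_totalMean r h03 h12
  have h03' : 0 < (r 0 + r 3 : ℝ) := by exact_mod_cast pos_iff_ne_zero.2 h03
  have h12' : 0 < (r 1 + r 2 : ℝ) := by exact_mod_cast pos_iff_ne_zero.2 h12
  have := (h2.const_mul (((r 0 * r 2 - r 1 * r 3) / ((r 0 + r 3) * (r 1 + r 2)) : ℝ) ^ 2)).add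
    (h1.const_mul ((r 0 * r 3) / (r 0 + r 3) ^ 2 + (r 1 * r 2) / (r 1 + r 2) ^ 2 : ℝ))
  rw [mul_zero, mul_zero, add_zero] at this
  refine this.congr' ?_
  filter_upwards [eventually_ne_atTop 0] with n hn
  have hn' : (n : ℝ≥0) ≠ 0 := by exact_mod_cast hn
  have hn'' : (n : ℝ) ≠ 0 := by exact_mod_cast hn
  rw [variance_sub_balancedLaw _ (by rw [← mul_add]; positivity) (by rw [← mul_add]; positivity),
    varLead, varCorr, rpow_three_halves (by positivity)]
  set q := Real.sqrt ((r 0 + r 3) * (r 1 + r 2)) with hqdef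
  have hq : 0 < q := Real.sqrt_pos.2 (by positivity)
  have hq2 : q ^ 2 = (r 0 + r 3) * (r 1 + r 2) := Real.sq_sqrt (by positivity)
  set m := totalMean fun i => n * r i
  push_cast
  generalize (r 0 : ℝ) = a at *
  generalize (r 1 : ℝ) = b at *
  generalize (r 2 : ℝ) = c at *
  generalize (r 3 : ℝ) = d at *
  have e1 : ((n * a) * (n * c) - (n * b) * (n * d)) / ((n * a + n * d) * (n * b + n * c)) =
      (a * c - b * d) / ((a + d) * (b + c)) := by
    field_simp
  have e2 : (n * a) * (n * d) / (n * a + n * d : ℝ) ^ 2 = a * d / (a + d) ^ 2 := by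
    field_simp
  have e3 : (n * b) * (n * c) / (n * b + n * c : ℝ) ^ 2 = b * c / (b + c) ^ 2 := by
    field_simp
  have e4 : (n * a + n * d) * (n * b + n * c) = (n * q) ^ 2 := by
    rw [mul_pow, hq2]; ring
  -- `V` and `V'` come from `m ≈ n q - 1/4` and `s² - m² ≈ n q / 2`: the splitting variance yields
  -- both, the variance of `K` only contributes to `V`.
  have e5 : (a * c + 2 * (a * b) + b * d) * (a * c + 2 * (c * d) + b * d) / (2 * q ^ 3) =
      q * ((a * d / (a + d) ^ 2 + b * c / (b + c) ^ 2) +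
        ((a * c - b * d) / ((a + d) * (b + c))) ^ 2 / 2) := by
    rw [div_eq_iff (by positivity), show q * (a * d / (a + d) ^ 2 + b * c / (b + c) ^ 2 +
      ((a * c - b * d) / ((a + d) * (b + c))) ^ 2 / 2) * (2 * q ^ 3) =
      (q ^ 2) ^ 2 * (2 * (a * d / (a + d) ^ 2 + b * c / (b + c) ^ 2) +
      ((a * c - b * d) / ((a + d) * (b + c))) ^ 2) by ring, hq2]
    field_simp
    ring
  have e6 : -(((a * c + b * d) * (a * b + c * d) + 4 * (a * b * c * d)) /
      (4 * ((a + d) * (b + c)) ^ 2)) = -(a * d / (a + d) ^ 2 + b * c / (b + c) ^ 2) / 4 := by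
    field_simp
    ring
  rw [e1, e2, e3, e4, e5, e6]
  ring

/-! ### Invariance of the conditioned law under tilting -/

/-- Rates giving the same conditioned law as `r`. -/
def tilt (ρ : ℝ≥0) (r : Fin 4 → ℝ≥0) : Fin 4 → ℝ≥0 :=
  ![ρ * r 0, ρ⁻¹ * r 1, ρ⁻¹ * r 2, ρ * r 3]

/-- On the balance set the powers of `ρ` cancel, so the weights change by the constant `c` only,
which conditioning removes. -/
theorem balancedLaw_tilt {ρ : ℝ≥0} (hρ : ρ ≠ 0) (r : Fin 4 → ℝ≥0) :
    balancedLaw (tilt ρ r) = balancedLaw r := by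
  set c : ℝ := Real.exp ((r 0 + r 1 + r 2 + r 3) - (ρ * r 0 + (ρ : ℝ)⁻¹ * r 1 + (ρ : ℝ)⁻¹ * r 2 + ρ * r 3))
    with hc
  have hc0 : 0 < c := Real.exp_pos _
  have hρ' : (ρ : ℝ) ≠ 0 := by exact_mod_cast hρ
  have h : (poissonPi (tilt ρ r)).restrict balanceSet =
      ENNReal.ofReal c • (poissonPi r).restrict balanceSet := by
    refine Measure.ext_of_singleton fun x => ?_
    rw [Measure.smul_apply, Measure.restrict_apply .of_discrete, Measure.restrict_apply .of_discrete]
    by_cases hx : x ∈ balanceSet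
    · rw [Set.inter_eq_left.2 (Set.singleton_subset_iff.2 hx), poissonPi_singleton,
        poissonPi_singleton, smul_eq_mul, ← ENNReal.ofReal_mul hc0.le]
      congr 1
      have hx' : x 0 + x 3 = x 1 + x 2 := by
        simp only [balanceSet, Set.mem_ofPred_eq] at hx
        omega
      have hpow : (ρ : ℝ) ^ x 0 * ρ ^ x 3 = ρ ^ x 1 * ρ ^ x 2 := by
        rw [← pow_add, ← pow_add, hx']
      have hexp : Real.exp (-(ρ * r 0)) * Real.exp (-((ρ : ℝ)⁻¹ * r 1)) * Real.exp (-((ρ : ℝ)⁻¹ * r 2)) *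
          Real.exp (-(ρ * r 3)) = c * (Real.exp (-(r 0)) * Real.exp (-(r 1)) * Real.exp (-(r 2)) *
          Real.exp (-(r 3))) := by
        rw [hc]
        simp only [← Real.exp_add]
        congr 1
        ring
      simp only [Fin.prod_univ_four, tilt, Matrix.cons_val, NNReal.coe_mul, NNReal.coe_inv, mul_pow,
        inv_pow]
      have : (ρ : ℝ) ^ x 0 * ρ ^ x 3 * ((ρ : ℝ) ^ x 1)⁻¹ * ((ρ : ℝ) ^ x 2)⁻¹ = 1 := by
        rw [hpow]
        field_simp
      set y := (r 0 : ℝ) ^ x 0 * r 1 ^ x 1 * r 2 ^ x 2 * r 3 ^ x 3 /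
        ((x 0).factorial * (x 1).factorial * (x 2).factorial * (x 3).factorial) with hy
      trans (Real.exp (-(ρ * r 0)) * Real.exp (-((ρ : ℝ)⁻¹ * r 1)) * Real.exp (-((ρ : ℝ)⁻¹ * r 2)) *
          Real.exp (-(ρ * r 3))) * ((ρ : ℝ) ^ x 0 * ρ ^ x 3 * ((ρ : ℝ) ^ x 1)⁻¹ *
          ((ρ : ℝ) ^ x 2)⁻¹) * y
      · rw [hy]; ring
      · rw [this, hexp, hy]; ring
    · rw [Set.singleton_inter_eq_empty.2 hx]; simp
  have hS : poissonPi (tilt ρ r) balanceSet = ENNReal.ofReal c * poissonPi r balanceSet := by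
    simpa using congrArg (fun μ => μ Set.univ) h
  have hcE : ENNReal.ofReal c ≠ 0 := by simpa using hc0
  rw [balancedLaw, balancedLaw, ProbabilityTheory.cond, ProbabilityTheory.cond, h, hS, smul_smul,
    ENNReal.mul_inv (Or.inl hcE) (Or.inl ENNReal.ofReal_ne_top), mul_right_comm,
    ENNReal.inv_mul_cancel hcE ENNReal.ofReal_ne_top, one_mul]

/-! ### Fourier inversion and Gaussian limit of the integrals -/

/-- The frequencies of the four coordinates in `t * (x 0 - x 1) + θ * (x 0 - x 1 - x 2 + x 3)`. -/
def freq (t θ : ℝ) : Fin 4 → ℝ := ![t + θ, -(t + θ), -θ, θ]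

theorem integral_cexp_poissonPi {ι : Type*} [Fintype ι] (r : ι → ℝ≥0) (w : ι → ℝ) :
    ∫ x, Complex.exp (∑ i, (x i : ℂ) * w i * Complex.I) ∂poissonPi r =
      Complex.exp (∑ i, (r i : ℂ) * (Complex.exp (w i * Complex.I) - 1)) := by
  simp only [Complex.exp_sum]
  rw [poissonPi, integral_fintype_prod_eq_prod (μ := fun i => poissonMeasure (r i))
    (f := fun i (k : ℕ) => Complex.exp ((k : ℂ) * w i * Complex.I))]
  refine Finset.prod_congr rfl fun i _ => ?_
  have h := charFun_map_cast_poissonMeasure (r i) (w i)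
  rw [charFun_apply_real, integral_map .of_discrete (by fun_prop)] at h
  rw [← h]
  congr 1
  ext k
  push_cast
  ring_nf

theorem integral_cexp_int_mul (k : ℤ) :
    ∫ θ in (-Real.pi)..Real.pi, Complex.exp (θ * k * Complex.I) =
      if k = 0 then (2 * Real.pi : ℂ) else 0 := by
  split_ifs with hk
  · simp [hk]; ring
  · have hk' : (k : ℂ) * Complex.I ≠ 0 := by simp [hk]
    have := integral_exp_mul_complex (a := -Real.pi) (b := Real.pi) hk'
    simp only [mul_comm, mul_assoc, mul_left_comm] at this ⊢
    rw [this, div_eq_zero_iff]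
    left
    rw [sub_eq_zero, Complex.exp_eq_exp_iff_exists_int]
    refine ⟨k, ?_⟩
    push_cast
    ring

/-- Fourier inversion in the balance variable. -/
theorem two_pi_mul_integral_indicator_cexp (r : Fin 4 → ℝ≥0) (t : ℝ) :
    (2 * Real.pi : ℂ) * ∫ x, balanceSet.indicator
        (fun x => Complex.exp (t * ((x 0 : ℝ) - x 1 : ℝ) * Complex.I)) x ∂poissonPi r =
      ∫ θ in (-Real.pi)..Real.pi,
        Complex.exp (∑ i, (r i : ℂ) * (Complex.exp (freq t θ i * Complex.I) - 1)) := by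
  simp only [← integral_cexp_poissonPi]
  rw [intervalIntegral.integral_of_le (by linarith [Real.pi_pos]), integral_integral_swap,
    ← integral_const_mul]
  · refine integral_congr_ae (ae_of_all _ fun x => ?_)
    beta_reduce
    rw [← intervalIntegral.integral_of_le (by linarith [Real.pi_pos])]
    -- For fixed `x` the dependence on `θ` is a single character whose integer frequency vanishes
    -- exactly on the balance set.
    have h (θ : ℝ) : Complex.exp (∑ i, (x i : ℂ) * freq t θ i * Complex.I) =
        Complex.exp (t * ((x 0 : ℝ) - x 1 : ℝ) * Complex.I) *
        Complex.exp (θ * ((x 0 - x 1 - x 2 + x 3 : ℤ)) * Complex.I) := by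
      rw [← Complex.exp_add]
      congr 1
      simp only [Fin.sum_univ_four, freq, Matrix.cons_val]
      push_cast
      ring
    simp only [h]
    rw [intervalIntegral.integral_const_mul, integral_cexp_int_mul]
    have hiff : (x 0 - x 1 - x 2 + x 3 : ℤ) = 0 ↔ x ∈ balanceSet := by
      simp only [balanceSet, Set.mem_ofPred_eq]
      omega
    by_cases hx : x ∈ balanceSet
    · rw [if_pos (hiff.2 hx), Set.indicator_of_mem hx, mul_comm]
    · rw [if_neg (mt hiff.1 hx), Set.indicator_of_notMem hx, mul_zero, mul_zero]
  · refine Integrable.of_bound (C := 1) ?_ (ae_of_all _ fun p => ?_)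
    · refine Measurable.aestronglyMeasurable ?_
      have hx (i : Fin 4) : Measurable fun p : ℝ × (Fin 4 → ℕ) => (p.2 i : ℂ) :=
        (Measurable.of_discrete (f := fun x : Fin 4 → ℕ => (x i : ℂ))).comp measurable_snd
      simp only [Function.uncurry_def, Fin.sum_univ_four, freq, Matrix.cons_val]
      have h0 := hx 0
      have h1 := hx 1
      have h2 := hx 2
      have h3 := hx 3
      fun_prop
    · simp only [Function.uncurry_def]
      rw [← Finset.sum_mul]
      have : (∑ i, (p.2 i : ℂ) * freq t p.1 i) = ((∑ i, (p.2 i : ℝ) * freq t p.1 i : ℝ) : ℂ) := by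
        push_cast; rfl
      rw [this, Complex.norm_exp_ofReal_mul_I]

theorem tendsto_nat_mul_cexp_sub (w : ℝ) :
    Tendsto (fun n : ℕ => (n : ℂ) * (Complex.exp ((w / Real.sqrt n : ℝ) * Complex.I) - 1 -
      (w / Real.sqrt n : ℝ) * Complex.I)) atTop (𝓝 (-(w ^ 2 : ℝ) / 2)) := by
  have hsq : Tendsto (fun n : ℕ => Real.sqrt n) atTop atTop :=
    Real.tendsto_sqrt_atTop.comp tendsto_natCast_atTop_atTop
  have h0 : Tendsto (fun n : ℕ => |w| ^ 3 * (Real.sqrt n)⁻¹) atTop (𝓝 0) := by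
    simpa using (tendsto_inv_atTop_zero.comp hsq).const_mul (|w| ^ 3)
  rw [tendsto_iff_norm_sub_tendsto_zero]
  refine squeeze_zero' (Eventually.of_forall fun n => norm_nonneg _) ?_ h0
  -- This threshold gives `√n > 0` and `‖z‖ ≤ 1`, as the Taylor bound requires; the cubic remainder
  -- times `n` is at most `|w|³/√n`.
  filter_upwards [hsq.eventually_ge_atTop (|w| + 1)] with n hn
  have hq : 0 < Real.sqrt n := by linarith [abs_nonneg w]
  have hn2 : (n : ℝ) = Real.sqrt n ^ 2 := (Real.sq_sqrt n.cast_nonneg).symm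
  set q := Real.sqrt n
  set z : ℂ := (w / q : ℝ) * Complex.I with hz
  have hzn : ‖z‖ = |w| / q := by simp [hz, abs_of_pos hq]
  have hz1 : ‖z‖ ≤ 1 := by
    rw [hzn, div_le_one hq]
    linarith
  have hb := Complex.exp_bound hz1 (n := 3) (by norm_num)
  have hz2 : (n : ℂ) * (z ^ 2 / 2) = -(w ^ 2 : ℝ) / 2 := by
    rw [← Complex.ofReal_natCast, hn2, hz, mul_pow, Complex.I_sq]
    have : (q : ℂ) ≠ 0 := by exact_mod_cast hq.ne'
    push_cast
    field_simp
  have he : (n : ℂ) * (Complex.exp z - 1 - z) - -(w ^ 2 : ℝ) / 2 =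
      n * (Complex.exp z - ∑ m ∈ Finset.range 3, z ^ m / m.factorial) := by
    rw [← hz2]
    simp [Finset.sum_range_succ, Nat.factorial]
    ring
  rw [he, norm_mul, Complex.norm_natCast, hn2]
  calc q ^ 2 * ‖Complex.exp z - ∑ m ∈ Finset.range 3, z ^ m / m.factorial‖
      ≤ q ^ 2 * (‖z‖ ^ 3 * 1) := by
        refine mul_le_mul_of_nonneg_left (hb.trans ?_) (by positivity)
        refine mul_le_mul_of_nonneg_left ?_ (by positivity)
        norm_num [Nat.factorial]
    _ = |w| ^ 3 * q⁻¹ := by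
        rw [hzn]
        field_simp

/-- The Gaussian integral arising in the limit. -/
theorem integral_exp_quadratic {p m : ℝ} (hpm : 0 < p + m) (τ : ℝ) :
    ∫ v : ℝ, Real.exp (-(p * (τ + v) ^ 2 + m * v ^ 2) / 2) =
      Real.exp (-(p * m / (p + m) * τ ^ 2) / 2) * Real.sqrt (2 * Real.pi / (p + m)) := by
  have h (v : ℝ) : Real.exp (-(p * (τ + v) ^ 2 + m * v ^ 2) / 2) =
      Real.exp (-(p * m / (p + m) * τ ^ 2) / 2) *
        Real.exp (-((p + m) / 2) * (v + p / (p + m) * τ) ^ 2) := by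
    rw [← Real.exp_add]
    congr 1
    field_simp
    ring
  simp only [h]
  rw [integral_const_mul,
    integral_add_right_eq_self (fun v => Real.exp (-((p + m) / 2) * v ^ 2)), integral_gaussian]
  congr 2
  field_simp

/-- The rescaled Fourier integrand. -/
def scaledIntegrand (r : Fin 4 → ℝ≥0) (τ : ℝ) (n : ℕ) (v : ℝ) : ℂ :=
  Complex.exp (∑ i, (r i : ℂ) * ((n : ℂ) *
    (Complex.exp ((freq τ v i / Real.sqrt n : ℝ) * Complex.I) - 1 -
      (freq τ v i / Real.sqrt n : ℝ) * Complex.I)))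

/-- The modulus only sees the terms `cos - 1`. Those of coordinates 0 and 1 are nonpositive and
dropped; those of 2 and 3 satisfy `cos x ≤ 1 - (2/π²) x²` on `|x| ≤ π`, a Gaussian bound independent
of `n` and `τ`. -/
theorem norm_scaledIntegrand_le (r : Fin 4 → ℝ≥0) (τ : ℝ) {n : ℕ} (hn : n ≠ 0) {v : ℝ}
    (hv : |v| ≤ Real.pi * Real.sqrt n) :
    ‖scaledIntegrand r τ n v‖ ≤ Real.exp (-((r 2 + r 3) * (2 / Real.pi ^ 2)) * v ^ 2) := by
  have hn0 : 0 < (n : ℝ) := by positivity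
  have hq : 0 < Real.sqrt n := Real.sqrt_pos.2 hn0
  have hre (x : ℝ) : ((n : ℂ) * (Complex.exp ((x : ℂ) * Complex.I) - 1 - (x : ℂ) * Complex.I)).re =
      n * (Real.cos x - 1) := by
    rw [← Complex.ofReal_natCast, Complex.re_ofReal_mul]
    simp [Complex.exp_ofReal_mul_I_re]
  have hre' (i : Fin 4) (x : ℝ) : ((r i : ℂ) * ((n : ℂ) *
      (Complex.exp ((x : ℂ) * Complex.I) - 1 - (x : ℂ) * Complex.I))).re =
      r i * (n * (Real.cos x - 1)) := by
    rw [Complex.re_ofReal_mul, hre]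
  rw [scaledIntegrand, Complex.norm_exp, Real.exp_le_exp, Complex.re_sum]
  simp only [hre', Fin.sum_univ_four, freq, Matrix.cons_val, neg_div, Real.cos_neg]
  have hc : Real.cos ((τ + v) / Real.sqrt n) - 1 ≤ 0 := by linarith [Real.cos_le_one ((τ + v) / Real.sqrt n)]
  have hcv : n * (Real.cos (v / Real.sqrt n) - 1) ≤ -(2 / Real.pi ^ 2) * v ^ 2 := by
    have h := Real.cos_le_one_sub_mul_cos_sq (x := v / Real.sqrt n)
      (by rw [abs_div, abs_of_pos hq, div_le_iff₀ hq]; exact hv)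
    rw [div_pow, Real.sq_sqrt hn0.le] at h
    calc n * (Real.cos (v / Real.sqrt n) - 1) ≤ n * (-(2 / Real.pi ^ 2 * (v ^ 2 / n))) := by
          gcongr
          linarith
      _ = _ := by field_simp
  have h1 : (n : ℝ) * (Real.cos ((τ + v) / Real.sqrt n) - 1) ≤ 0 :=
    mul_nonpos_of_nonneg_of_nonpos hn0.le hc
  have e0 := mul_nonpos_of_nonneg_of_nonpos (r 0).coe_nonneg h1
  have e1 := mul_nonpos_of_nonneg_of_nonpos (r 1).coe_nonneg h1
  have e2 := mul_le_mul_of_nonneg_left hcv (r 2).coe_nonneg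
  have e3 := mul_le_mul_of_nonneg_left hcv (r 3).coe_nonneg
  linarith

theorem tendsto_scaledIntegrand (r : Fin 4 → ℝ≥0) (τ v : ℝ) :
    Tendsto (fun n => scaledIntegrand r τ n v) atTop
      (𝓝 (Real.exp (-((r 0 + r 1) * (τ + v) ^ 2 + (r 2 + r 3) * v ^ 2) / 2) : ℝ)) := by
  have h : Tendsto (fun n => scaledIntegrand r τ n v) atTop
      (𝓝 (Complex.exp (∑ i, (r i : ℂ) * (-(freq τ v i ^ 2 : ℝ) / 2)))) := by
    refine (Complex.continuous_exp.tendsto _).comp ?_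
    exact tendsto_finsetSum _ fun i _ => (tendsto_nat_mul_cexp_sub (freq τ v i)).const_mul _
  convert h using 2
  rw [Complex.ofReal_exp]
  congr 1
  simp only [Fin.sum_univ_four, freq, Matrix.cons_val]
  push_cast
  ring

theorem tendsto_integral_scaledIntegrand (r : Fin 4 → ℝ≥0) (h23 : 0 < r 2 + r 3) (τ : ℝ) :
    Tendsto (fun n : ℕ => ∫ v in (-(Real.pi * Real.sqrt n))..(Real.pi * Real.sqrt n),
        scaledIntegrand r τ n v) atTop
      (𝓝 (∫ v : ℝ, Real.exp (-((r 0 + r 1) * (τ + v) ^ 2 + (r 2 + r 3) * v ^ 2) / 2) : ℝ)) := by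
  have h23' : 0 < (r 2 + r 3 : ℝ) := by exact_mod_cast h23
  have hsq : Tendsto (fun n : ℕ => Real.pi * Real.sqrt n) atTop atTop :=
    (Real.tendsto_sqrt_atTop.comp tendsto_natCast_atTop_atTop).const_mul_atTop Real.pi_pos
  have hle (n : ℕ) : -(Real.pi * Real.sqrt n) ≤ Real.pi * Real.sqrt n := by
    have : 0 ≤ Real.pi * Real.sqrt n := by positivity
    linarith
  rw [← integral_complex_ofReal]
  have hset (n : ℕ) : ∫ v in (-(Real.pi * Real.sqrt n))..(Real.pi * Real.sqrt n),
      scaledIntegrand r τ n v = ∫ v, (Set.Ioc (-(Real.pi * Real.sqrt n))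
        (Real.pi * Real.sqrt n)).indicator (scaledIntegrand r τ n) v := by
    rw [intervalIntegral.integral_of_le (hle n), integral_indicator measurableSet_Ioc]
  simp only [hset]
  refine tendsto_integral_filter_of_dominated_convergence
    (fun v => Real.exp (-((r 2 + r 3) * (2 / Real.pi ^ 2)) * v ^ 2)) ?_ ?_ ?_ ?_
  · refine Eventually.of_forall fun n => ?_
    refine (Continuous.aestronglyMeasurable ?_).indicator measurableSet_Ioc
    change Continuous fun v => scaledIntegrand r τ n v
    simp only [scaledIntegrand, Fin.sum_univ_four, freq, Matrix.cons_val]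
    fun_prop
  · filter_upwards [eventually_ne_atTop 0] with n hn
    refine ae_of_all _ fun v => ?_
    by_cases hv : v ∈ Set.Ioc (-(Real.pi * Real.sqrt n)) (Real.pi * Real.sqrt n)
    · rw [Set.indicator_of_mem hv]
      exact norm_scaledIntegrand_le r τ hn (abs_le.2 ⟨hv.1.le, hv.2⟩)
    · rw [Set.indicator_of_notMem hv, norm_zero]
      positivity
  · exact integrable_exp_neg_mul_sq (by positivity)
  · refine ae_of_all _ fun v => ?_
    refine (tendsto_scaledIntegrand r τ v).congr' ?_
    filter_upwards [hsq.eventually_ge_atTop (|v| + 1)] with n hn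
    rw [Set.indicator_of_mem]
    have h := abs_le.1 (show |v| ≤ Real.pi * Real.sqrt n - 1 by linarith)
    exact ⟨by linarith, by linarith⟩

theorem integral_scaledIntegrand (r : Fin 4 → ℝ≥0) (hr : r 0 + r 3 = r 1 + r 2) (τ : ℝ) {n : ℕ}
    (hn : n ≠ 0) :
    ∫ v in (-(Real.pi * Real.sqrt n))..(Real.pi * Real.sqrt n), scaledIntegrand r τ n v =
      Real.sqrt n * (2 * Real.pi) * ∫ x, balanceSet.indicator (fun x : Fin 4 → ℕ =>
        Complex.exp ((τ / Real.sqrt n : ℝ) * ((x 0 : ℝ) - x 1 - n * (r 0 - r 1) : ℝ) * Complex.I)) x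
        ∂poissonPi (fun i => n * r i) := by
  have hn0 : 0 < (n : ℝ) := by positivity
  have hq : Real.sqrt n ≠ 0 := (Real.sqrt_pos.2 hn0).ne'
  set q := Real.sqrt n with hqdef
  have hqc : (q : ℂ) ≠ 0 := by exact_mod_cast hq
  have hr' : (r 0 : ℝ) + r 3 = r 1 + r 2 := by exact_mod_cast hr
  have hrc : ((r 0 : ℝ) : ℂ) + (r 3 : ℝ) = (r 1 : ℝ) + (r 2 : ℝ) := by exact_mod_cast hr'
  set κ : ℂ := Complex.exp (-((τ / q : ℝ) * (n * (r 0 - r 1) : ℝ) * Complex.I)) with hκ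
  have hind : (fun x : Fin 4 → ℕ => balanceSet.indicator (fun x : Fin 4 → ℕ =>
      Complex.exp ((τ / q : ℝ) * ((x 0 : ℝ) - x 1 - n * (r 0 - r 1) : ℝ) * Complex.I)) x) =
      fun x => κ * balanceSet.indicator (fun x : Fin 4 → ℕ =>
        Complex.exp ((τ / q : ℝ) * ((x 0 : ℝ) - x 1 : ℝ) * Complex.I)) x := by
    ext x
    by_cases hx : x ∈ balanceSet
    · rw [Set.indicator_of_mem hx, Set.indicator_of_mem hx, hκ, ← Complex.exp_add]
      congr 1
      push_cast
      ring
    · rw [Set.indicator_of_notMem hx, Set.indicator_of_notMem hx, mul_zero]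
  have hscale (v : ℝ) : scaledIntegrand r τ n v = κ * Complex.exp (∑ i,
      (((n : ℝ≥0) * r i : ℝ≥0) : ℂ) *
        (Complex.exp (freq (τ / q) (v / q) i * Complex.I) - 1)) := by
    rw [scaledIntegrand, hκ, ← Complex.exp_add]
    congr 1
    have hf (i : Fin 4) : freq (τ / q) (v / q) i = freq τ v i / q := by
      fin_cases i <;> simp [freq] <;> ring
    have hc (i : Fin 4) : ((r i : ℝ≥0) : ℂ) = ((r i : ℝ) : ℂ) := rfl
    have hm (i : Fin 4) : (((n : ℝ≥0) * r i : ℝ≥0) : ℂ) = (n : ℂ) * ((r i : ℝ) : ℂ) := by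
      rw [← hc]; simp
    -- The coefficient of `v` is proportional to `r 0 + r 3 - r 1 - r 2 = 0`; what remains is
    -- exactly the centering `n * (r 0 - r 1)`.
    have hlin : ∑ i, ((r i : ℝ) : ℂ) * (n * ((freq τ v i / q : ℝ) * Complex.I)) =
        (τ / q : ℝ) * (n * (r 0 - r 1) : ℝ) * Complex.I := by
      simp only [Fin.sum_univ_four, freq, Matrix.cons_val]
      push_cast
      linear_combination (n * (v / q) * Complex.I : ℂ) * hrc
    rw [← hlin, ← Finset.sum_neg_distrib, ← Finset.sum_add_distrib]
    refine Finset.sum_congr rfl fun i _ => ?_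
    rw [hf, hm, hc]
    ring
  have hfour := two_pi_mul_integral_indicator_cexp (fun i => n * r i) (τ / q)
  rw [hind, integral_const_mul]
  simp only [hscale]
  rw [intervalIntegral.integral_const_mul]
  have hdiv := intervalIntegral.integral_comp_div (a := -(Real.pi * q)) (b := Real.pi * q)
    (fun θ => Complex.exp (∑ i, (((n : ℝ≥0) * r i : ℝ≥0) : ℂ) *
        (Complex.exp (freq (τ / q) θ i * Complex.I) - 1))) hq
  rw [neg_div, mul_div_cancel_right₀ _ hq, ← hfour, Complex.real_smul] at hdiv
  rw [hdiv]
  ring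

/-- The probability of balance is the same Fourier integral at `τ = 0`, so all prefactors cancel in
the quotient. -/
theorem integral_cexp_balancedLaw (r : Fin 4 → ℝ≥0) (hr : r 0 + r 3 = r 1 + r 2) (τ : ℝ) {n : ℕ}
    (hn : n ≠ 0) :
    ∫ x, Complex.exp ((τ / Real.sqrt n : ℝ) * ((x 0 : ℝ) - x 1 - n * (r 0 - r 1) : ℝ) * Complex.I)
        ∂balancedLaw (fun i => n * r i) =
      (∫ v in (-(Real.pi * Real.sqrt n))..(Real.pi * Real.sqrt n), scaledIntegrand r τ n v) /
      ∫ v in (-(Real.pi * Real.sqrt n))..(Real.pi * Real.sqrt n), scaledIntegrand r 0 n v := by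
  have hn0 : 0 < (n : ℝ) := by positivity
  have hq : (Real.sqrt n : ℂ) ≠ 0 := by exact_mod_cast (Real.sqrt_pos.2 hn0).ne'
  have h1 := integral_balancedLaw (fun i => n * r i) fun _ => (1 : ℂ)
  simp only [integral_const, probReal_univ, one_smul] at h1
  have hP : (poissonPi fun i => n * r i).real balanceSet ≠ 0 := by
    rw [measureReal_ne_zero_iff]
    exact poissonPi_balanceSet_ne_zero _
  rw [integral_balancedLaw, integral_scaledIntegrand r hr τ hn, integral_scaledIntegrand r hr 0 hn]
  simp only [zero_div, Complex.ofReal_zero, zero_mul, Complex.exp_zero]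
  rw [Complex.real_smul] at h1 ⊢
  have hpi : (Real.pi : ℂ) ≠ 0 := by exact_mod_cast Real.pi_ne_zero
  have hPc : ((poissonPi fun i => n * r i).real balanceSet : ℂ) ≠ 0 := by exact_mod_cast hP
  have h1' : ∫ x, balanceSet.indicator (fun _ => (1 : ℂ)) x ∂poissonPi (fun i => n * r i) =
      ((poissonPi fun i => n * r i).real balanceSet : ℂ) := by
    rw [Complex.ofReal_inv, eq_inv_mul_iff_mul_eq₀ hPc, mul_one] at h1
    exact h1.symm
  rw [h1', Complex.ofReal_inv, mul_div_mul_left _ _ (by simp [hq]), inv_mul_eq_div]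

theorem tendsto_charFun_balancedLaw (r : Fin 4 → ℝ≥0) (hr : r 0 + r 3 = r 1 + r 2)
    (h23 : 0 < r 2 + r 3) (τ : ℝ) :
    Tendsto (fun n : ℕ => ∫ x, Complex.exp ((τ / Real.sqrt n : ℝ) *
        ((x 0 : ℝ) - x 1 - n * (r 0 - r 1) : ℝ) * Complex.I) ∂balancedLaw (fun i => n * r i)) atTop
      (𝓝 (Real.exp (-((r 0 + r 1) * (r 2 + r 3) / ((r 0 + r 1) + (r 2 + r 3)) * τ ^ 2) / 2) : ℝ)) := by
  have h23' : 0 < (r 2 + r 3 : ℝ) := by exact_mod_cast h23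
  have hpm : 0 < (r 0 + r 1 : ℝ) + (r 2 + r 3) := by positivity
  have hT := tendsto_integral_scaledIntegrand r h23 τ
  have h0 := tendsto_integral_scaledIntegrand r h23 0
  rw [integral_exp_quadratic hpm] at hT h0
  have hs : 0 < Real.sqrt (2 * Real.pi / ((r 0 + r 1 : ℝ) + (r 2 + r 3))) :=
    Real.sqrt_pos.2 (by positivity)
  have hdiv := hT.div h0 (by
    rw [Complex.ofReal_ne_zero]
    exact (mul_pos (Real.exp_pos _) hs).ne')
  rw [← Complex.ofReal_div, mul_div_mul_right _ _ hs.ne'] at hdiv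
  norm_num at hdiv
  refine Tendsto.congr' ?_ (by convert hdiv using 2; push_cast; norm_num)
  filter_upwards [eventually_ne_atTop 0] with n hn
  exact (integral_cexp_balancedLaw r hr τ hn).symm

/-! ### The limiting constants and the central limit theorem -/

/-- In `ℝ≥0` a vanishing factor of the numerator kills each of its products, which forces two
cyclically adjacent rates to vanish. -/
theorem varLead_pos {a b c d : ℝ≥0} (h : ¬ Degenerate a b c d) : 0 < varLead a b c d := by
  simp only [Degenerate, not_or, not_and] at h
  obtain ⟨hab, hbc, hcd, hda⟩ := h
  have had : 0 < a + d := by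
    rw [add_comm]
    rcases eq_or_ne d 0 with hd | hd
    · exact add_pos_of_nonneg_of_pos zero_le (pos_iff_ne_zero.2 (hda hd))
    · exact add_pos_of_pos_of_nonneg (pos_iff_ne_zero.2 hd) zero_le
  have hbc' : 0 < b + c := by
    rcases eq_or_ne b 0 with hb | hb
    · exact add_pos_of_nonneg_of_pos zero_le (pos_iff_ne_zero.2 (hbc hb))
    · exact add_pos_of_pos_of_nonneg (pos_iff_ne_zero.2 hb) zero_le
  have h1 : 0 < a * c + 2 * (a * b) + b * d := by
    rw [pos_iff_ne_zero]
    intro h0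
    simp only [add_eq_zero, mul_eq_zero, OfNat.ofNat_ne_zero, false_or] at h0
    tauto
  have h2 : 0 < a * c + 2 * (c * d) + b * d := by
    rw [pos_iff_ne_zero]
    intro h0
    simp only [add_eq_zero, mul_eq_zero, OfNat.ofNat_ne_zero, false_or] at h0
    tauto
  have h1' : (0 : ℝ) < a * c + 2 * (a * b) + b * d := by exact_mod_cast h1
  have h2' : (0 : ℝ) < a * c + 2 * (c * d) + b * d := by exact_mod_cast h2
  have had' : (0 : ℝ) < a + d := by exact_mod_cast had
  have hbc'' : (0 : ℝ) < b + c := by exact_mod_cast hbc'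
  unfold varLead
  positivity

theorem meanLead_of_add_eq {a b c d : ℝ} (h : a + d = b + c) (hpos : 0 < a + d) :
    meanLead a b c d = a - b := by
  rw [meanLead, ← h, Real.sqrt_mul_self hpos.le, div_eq_iff hpos.ne']
  linear_combination -a * h

theorem varLead_of_add_eq {a b c d : ℝ} (h : a + d = b + c) (hpos : 0 < a + d) :
    varLead a b c d = (a + b) * (c + d) / ((a + b) + (c + d)) := by
  rw [varLead, rpow_three_halves (by rw [← h]; positivity), ← h, Real.sqrt_mul_self hpos.le]
  have hs : (a + b) + (c + d) = 2 * (a + d) := by linarith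
  rw [hs]
  obtain rfl : c = a + d - b := by linarith
  field_simp
  ring

theorem tilt_smul (ρ : ℝ≥0) (k : ℝ≥0) (r : Fin 4 → ℝ≥0) :
    tilt ρ (fun i => k * r i) = fun i => k * tilt ρ r i := by
  ext i
  fin_cases i <;> simp [tilt] <;> ring

/-- Only products of one rate from `r 0, r 3` with one from `r 1, r 2` occur, and the tilt fixes
these. -/
theorem meanLead_tilt {ρ : ℝ≥0} (hρ : ρ ≠ 0) (r : Fin 4 → ℝ≥0) :
    meanLead (tilt ρ r 0) (tilt ρ r 1) (tilt ρ r 2) (tilt ρ r 3) =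
      meanLead (r 0) (r 1) (r 2) (r 3) := by
  have hρ' : (ρ : ℝ) ≠ 0 := by exact_mod_cast hρ
  simp only [tilt, Matrix.cons_val, meanLead, NNReal.coe_mul, NNReal.coe_inv]
  congr 1
  · field_simp
  · congr 1
    field_simp

theorem varLead_tilt {ρ : ℝ≥0} (hρ : ρ ≠ 0) (r : Fin 4 → ℝ≥0) :
    varLead (tilt ρ r 0) (tilt ρ r 1) (tilt ρ r 2) (tilt ρ r 3) =
      varLead (r 0) (r 1) (r 2) (r 3) := by
  have hρ' : (ρ : ℝ) ≠ 0 := by exact_mod_cast hρ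
  simp only [tilt, Matrix.cons_val, varLead, NNReal.coe_mul, NNReal.coe_inv]
  congr 1
  · field_simp
  · congr 2
    field_simp

theorem exists_tilt_balanced (r : Fin 4 → ℝ≥0) (h03 : r 0 + r 3 ≠ 0) (h12 : r 1 + r 2 ≠ 0) :
    ∃ ρ : ℝ≥0, ρ ≠ 0 ∧ tilt ρ r 0 + tilt ρ r 3 = tilt ρ r 1 + tilt ρ r 2 := by
  refine ⟨NNReal.sqrt ((r 1 + r 2) / (r 0 + r 3)), by simp [h03, h12], ?_⟩
  set ρ := NNReal.sqrt ((r 1 + r 2) / (r 0 + r 3)) with hρ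
  have hρ0 : ρ ≠ 0 := by simp [hρ, h03, h12]
  have hsq : ρ * ρ = (r 1 + r 2) / (r 0 + r 3) := NNReal.mul_self_sqrt _
  simp only [tilt, Matrix.cons_val]
  rw [← mul_add, ← mul_add, eq_inv_mul_iff_mul_eq₀ hρ0, ← mul_assoc, hsq, div_mul_cancel₀ _ h03]

theorem tendsto_integral_cexp_normalized (r : Fin 4 → ℝ≥0)
    (h : ¬ Degenerate (r 0) (r 1) (r 2) (r 3)) (u : ℝ) :
    Tendsto (fun n : ℕ => ∫ x, Complex.exp (u * (((x 0 : ℝ) - x 1 -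
        n * meanLead (r 0) (r 1) (r 2) (r 3)) /
          Real.sqrt (n * varLead (r 0) (r 1) (r 2) (r 3)) : ℝ) * Complex.I)
        ∂balancedLaw (fun i => n * r i)) atTop (𝓝 (Complex.exp (-(u ^ 2) / 2))) := by
  have hV := varLead_pos h
  simp only [Degenerate, not_or, not_and] at h
  obtain ⟨hab, hbc, hcd, hda⟩ := h
  have h03 : r 0 + r 3 ≠ 0 := by
    intro h0
    simp only [add_eq_zero] at h0
    tauto
  have h12 : r 1 + r 2 ≠ 0 := by
    intro h0
    simp only [add_eq_zero] at h0
    tauto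
  obtain ⟨ρ, hρ, hbal⟩ := exists_tilt_balanced r h03 h12
  have hlaw (n : ℕ) : balancedLaw (fun i => n * r i) = balancedLaw (fun i => n * tilt ρ r i) := by
    rw [← tilt_smul, balancedLaw_tilt hρ]
  have hbal' : (tilt ρ r 0 : ℝ) + tilt ρ r 3 = tilt ρ r 1 + tilt ρ r 2 := by exact_mod_cast hbal
  have h23 : 0 < tilt ρ r 2 + tilt ρ r 3 := by
    rw [pos_iff_ne_zero]
    intro h0
    simp only [tilt, Matrix.cons_val, add_eq_zero, mul_eq_zero, inv_eq_zero, hρ, false_or] at h0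
    tauto
  have h03' : 0 < (tilt ρ r 0 : ℝ) + tilt ρ r 3 := by
    have : 0 < tilt ρ r 0 + tilt ρ r 3 := by
      simp only [tilt, Matrix.cons_val, ← mul_add]
      positivity
    exact_mod_cast this
  rw [← varLead_tilt hρ] at hV ⊢
  rw [← meanLead_tilt hρ]
  simp only [hlaw]
  have hE := meanLead_of_add_eq hbal' h03'
  have hVeq := varLead_of_add_eq hbal' h03'
  set V := varLead (tilt ρ r 0) (tilt ρ r 1) (tilt ρ r 2) (tilt ρ r 3)
  -- The frequency `u / √V` normalizes the limiting variance to 1.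
  have hT := tendsto_charFun_balancedLaw (tilt ρ r) hbal h23 (u / Real.sqrt V)
  rw [← hVeq, div_pow, Real.sq_sqrt hV.le, mul_div_cancel₀ _ hV.ne', ← hE] at hT
  convert hT using 3 with n
  · ext x
    congr 2
    rw [← Complex.ofReal_mul, ← Complex.ofReal_mul, Real.sqrt_mul n.cast_nonneg]
    congr 1
    rw [div_div, mul_div_assoc', div_mul_eq_mul_div, mul_comm (Real.sqrt V)]
  · push_cast
    rfl

/-! ### The degenerate case and transfer to the given probability spaces -/

/-- At rate zero the size-biased measure is zero, so its density `x i` vanishes almost everywhere.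
-/
theorem ae_coord_eq_zero {r : Fin 4 → ℝ≥0} {i : Fin 4} (h : r i = 0) :
    ∀ᵐ x ∂balancedLaw r, x i = 0 := by
  have h0 := withDensity_poissonPi r i
  rw [h, ENNReal.coe_zero, zero_smul, withDensity_eq_zero_iff Measurable.of_discrete.aemeasurable] at h0
  have := cond_absolutelyContinuous (s := balanceSet) |>.ae_le h0
  filter_upwards [this] with x hx
  simpa using hx

theorem ae_sub_eq_zero_of_degenerate {r : Fin 4 → ℝ≥0}
    (h : Degenerate (r 0) (r 1) (r 2) (r 3)) : ∀ᵐ x ∂balancedLaw r, (x 0 : ℝ) - x 1 = 0 := by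
  have key {i j : Fin 4} (hi : r i = 0) (hj : r j = 0)
      (hij : ∀ x ∈ balanceSet, x i = 0 → x j = 0 → x 0 = x 1) :
      ∀ᵐ x ∂balancedLaw r, (x 0 : ℝ) - x 1 = 0 := by
    filter_upwards [ae_balancedLaw r, ae_coord_eq_zero hi, ae_coord_eq_zero hj] with x hx h1 h2
    rw [hij x hx h1 h2, sub_self]
  simp only [balanceSet, Set.mem_ofPred_eq] at key
  rcases h with ⟨h1, h2⟩ | ⟨h1, h2⟩ | ⟨h1, h2⟩ | ⟨h1, h2⟩ <;>
    exact key h1 h2 fun x hx h3 h4 => by omega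

/-- The balance event is a preimage under the joint vector, so conditioning commutes with pushing
forward. -/
theorem hasLaw_balanceCond {Ω : Type*} [MeasurableSpace Ω] {μ : Measure Ω}
    {A B C D : Ω → ℕ} {r : Fin 4 → ℝ≥0} (hA : HasLaw A (poissonMeasure (r 0)) μ)
    (hB : HasLaw B (poissonMeasure (r 1)) μ) (hC : HasLaw C (poissonMeasure (r 2)) μ)
    (hD : HasLaw D (poissonMeasure (r 3)) μ) (hindep : iIndepFun ![A, B, C, D] μ) :
    HasLaw (fun ω i => ![A, B, C, D] i ω) (balancedLaw r) (balanceCond μ A B C D) := by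
  have hlaw (i : Fin 4) : HasLaw (![A, B, C, D] i) (poissonMeasure (r i)) μ := by
    fin_cases i
    · exact hA
    · exact hB
    · exact hC
    · exact hD
  set T : Ω → Fin 4 → ℕ := fun ω i => ![A, B, C, D] i ω
  have hT : AEMeasurable T μ := aemeasurable_pi_iff.2 fun i => (hlaw i).aemeasurable
  have hmap : μ.map T = poissonPi r := by
    rw [hindep.map_fun_eq_pi_map fun i => (hlaw i).aemeasurable, poissonPi]
    congr 1
    ext1 i
    exact (hlaw i).map_eq
  have hevent : balanceEvent A B C D = T ⁻¹' balanceSet := rfl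
  refine ⟨hT.mono_ac cond_absolutelyContinuous, ?_⟩
  rw [balanceCond, balancedLaw, ProbabilityTheory.cond, ProbabilityTheory.cond, Measure.map_smul,
    hevent, ← Measure.restrict_map_of_aemeasurable hT .of_discrete, hmap, ← hmap,
    Measure.map_apply_of_aemeasurable hT .of_discrete]

end BalancedPoisson
end

/-! ### Assembly of the result -/

theorem proposition1 {Ω : ℕ → Type*} [∀ n, MeasurableSpace (Ω n)]
    (μ : ∀ n, Measure (Ω n)) [∀ n, IsProbabilityMeasure (μ n)]
    (A B C D : ∀ n, Ω n → ℕ) (τA τB τC τD : ℝ≥0)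
    (hA : ∀ n, HasLaw (A n) (poissonMeasure ((n : ℝ≥0) * τA)) (μ n))
    (hB : ∀ n, HasLaw (B n) (poissonMeasure ((n : ℝ≥0) * τB)) (μ n))
    (hC : ∀ n, HasLaw (C n) (poissonMeasure ((n : ℝ≥0) * τC)) (μ n))
    (hD : ∀ n, HasLaw (D n) (poissonMeasure ((n : ℝ≥0) * τD)) (μ n))
    (hindep : ∀ n, iIndepFun ![A n, B n, C n, D n] (μ n)) :
    ∃ _ : ∀ n, IsProbabilityMeasure
        (BalancedPoisson.balanceCond (μ n) (A n) (B n) (C n) (D n)),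
      (BalancedPoisson.Degenerate τA τB τC τD →
        ∀ n, HasLaw (BalancedPoisson.netCount (A n) (B n)) (Measure.dirac (0 : ℝ))
          (BalancedPoisson.balanceCond (μ n) (A n) (B n) (C n) (D n))) ∧
      (¬ BalancedPoisson.Degenerate τA τB τC τD →
        (∀ n, MemLp (BalancedPoisson.netCount (A n) (B n)) 2
          (BalancedPoisson.balanceCond (μ n) (A n) (B n) (C n) (D n))) ∧
        (fun n : ℕ =>
          (∫ ω, BalancedPoisson.netCount (A n) (B n) ω
            ∂(BalancedPoisson.balanceCond (μ n) (A n) (B n) (C n) (D n)))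
          - ((n : ℝ) * BalancedPoisson.meanLead τA τB τC τD
            + BalancedPoisson.meanCorr τA τB τC τD))
          =o[atTop] (fun _ : ℕ => (1 : ℝ)) ∧
        (fun n : ℕ =>
          variance (BalancedPoisson.netCount (A n) (B n))
            (BalancedPoisson.balanceCond (μ n) (A n) (B n) (C n) (D n))
          - ((n : ℝ) * BalancedPoisson.varLead τA τB τC τD
            + BalancedPoisson.varCorr τA τB τC τD))
          =o[atTop] (fun _ : ℕ => (1 : ℝ)) ∧
        0 < BalancedPoisson.varLead τA τB τC τD ∧
        TendstoInDistribution
          (fun (n : ℕ) (ω : Ω n) =>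
            (BalancedPoisson.netCount (A n) (B n) ω
              - (n : ℝ) * BalancedPoisson.meanLead τA τB τC τD)
            / Real.sqrt ((n : ℝ) * BalancedPoisson.varLead τA τB τC τD))
          atTop (id : ℝ → ℝ)
          (fun n => BalancedPoisson.balanceCond (μ n) (A n) (B n) (C n) (D n))
          (gaussianReal 0 1)) := by
  set r : Fin 4 → ℝ≥0 := ![τA, τB, τC, τD] with hr
  have hT (n : ℕ) := BalancedPoisson.hasLaw_balanceCond (r := fun i => n * r i)
    (hA n) (hB n) (hC n) (hD n) (hindep n)
  have hprob (n : ℕ) : IsProbabilityMeasure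
      (BalancedPoisson.balanceCond (μ n) (A n) (B n) (C n) (D n)) := (hT n).isProbabilityMeasure
  have hmeas (f : (Fin 4 → ℕ) → ℝ) (n : ℕ) : AEMeasurable
      (fun ω => f (fun i => ![A n, B n, C n, D n] i ω))
      (BalancedPoisson.balanceCond (μ n) (A n) (B n) (C n) (D n)) :=
    (Measurable.of_discrete (f := f)).comp_aemeasurable (hT n).aemeasurable
  refine ⟨hprob, fun hdeg n => ⟨hmeas (fun x => (x 0 : ℝ) - x 1) n, ?_⟩, fun hdeg => ?_⟩
  · have hz := BalancedPoisson.ae_sub_eq_zero_of_degenerate (r := fun i => n * r i) (by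
      simp only [BalancedPoisson.Degenerate, mul_eq_zero]
      unfold BalancedPoisson.Degenerate at hdeg
      simp only [hr, Matrix.cons_val]
      tauto)
    rw [← (hT n).map_eq] at hz
    have hz' := ae_of_ae_map (hT n).aemeasurable hz
    refine (Measure.map_congr (g := fun _ => (0 : ℝ)) hz').trans ?_
    rw [Measure.map_const, measure_univ, one_smul]
  have h03 : r 0 + r 3 ≠ 0 := by
    intro h0
    simp only [add_eq_zero] at h0
    exact hdeg (Or.inr (Or.inr (Or.inr ⟨h0.2, h0.1⟩)))
  have h12 : r 1 + r 2 ≠ 0 := by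
    intro h0
    simp only [add_eq_zero] at h0
    exact hdeg (Or.inr (Or.inl h0))
  refine ⟨fun n => ?_, ?_, ?_, BalancedPoisson.varLead_pos hdeg, ?_⟩
  · have h := BalancedPoisson.memLp_sub_balancedLaw (fun i => n * r i)
    rw [← (hT n).map_eq] at h
    exact h.comp_of_map (hT n).aemeasurable
  · rw [isLittleO_one_iff]
    refine (BalancedPoisson.tendsto_mean_balancedLaw r h03 h12).congr fun n => ?_
    rw [← (hT n).integral_comp Measurable.of_discrete.aestronglyMeasurable]
    rfl
  · rw [isLittleO_one_iff]
    refine (BalancedPoisson.tendsto_variance_balancedLaw r h03 h12).congr fun n => ?_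
    rw [← (hT n).map_eq, variance_map Measurable.of_discrete.aemeasurable (hT n).aemeasurable]
    rfl
  · refine ⟨fun n => hmeas (fun x => ((x 0 : ℝ) - x 1 -
      n * BalancedPoisson.meanLead τA τB τC τD) /
        Real.sqrt (n * BalancedPoisson.varLead τA τB τC τD)) n, aemeasurable_id, ?_⟩
    -- By Lévy's theorem, pointwise convergence of the characteristic functions suffices.
    refine ProbabilityMeasure.tendsto_iff_tendsto_charFun.2 fun u => ?_
    simp only [ProbabilityMeasure.coe_mk, Measure.map_id]
    rw [charFun_gaussianReal]
    have h := BalancedPoisson.tendsto_integral_cexp_normalized r hdeg u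
    convert h using 2 with n
    · rw [charFun_apply_real, ← (hT n).integral_comp Measurable.of_discrete.aestronglyMeasurable]
      exact integral_map (hmeas (fun x => ((x 0 : ℝ) - x 1 -
        n * BalancedPoisson.meanLead τA τB τC τD) /
        Real.sqrt (n * BalancedPoisson.varLead τA τB τC τD)) n)
        (by fun_prop : Continuous fun x : ℝ => Complex.exp (u * x * Complex.I)).aestronglyMeasurable
    · simp [neg_div]
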